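/- **Improved bounds for estimating and sampling.** A hypergraph $\mathcal H$ on a finite vertex set $U$ with $n$ vertices is $d$-uniform if each of its hyperedges is a subset of $U$ of size exactly $d$; $m(\mathcal H)$ denotes its number of hyperedges. A *colorful independent set (CID) query* takes $d$ pairwise disjoint sets $A_1,\dots,A_d\subseteq U$ and answers Yes if and only if some hyperedge of $\mathcal H$ has exactly one vertex in each $A_i$. An algorithm here is a randomized adaptive query algorithm that knows $U$, $d$ and $\varepsilon$ and accesses $\mathcal H$ only through CID queries; its cost is the worst-case number of queries. There are an absolute constant $c>0$ and, for every integer $d\ge 1$, a constant $C_d>0$ depending only on $d$, such that for every finite set $U$ with $n$ vertices and every $\varepsilon\in(0,1)$ the following hold. 1. ($d$-Hyperedge-Estimation) There is an algorithm that makes at most $C_d\,\frac{(\log n)^{3d+5}}{\varepsilon^2}$ CID queries and that, for every $d$-uniform hypergraph $\mathcal H$ with vertex set $U$, outputs with probability at least $1-\frac1{n^{cd}}$ a number $\widehat m$ with $|m(\mathcal H)-\widehat m|\le\varepsilon\, m(\mathcal H)$. 2. ($d$-Hyperedge-Sample) There is an algorithm that makes at most $C_d\,\frac{(\log n)^{3d+9}}{\varepsilon^2}$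 CID queries and that, for every $d$-uniform hypergraph $\mathcal H$ with vertex set $U$ and $m=m(\mathcal H)\ge1$, reports, with probability at least $1-\frac1{n^{cd}}$, a sample from a distribution on the hyperedges of $\mathcal H$ under which every hyperedge has probability in $\left[(1-\varepsilon)\frac1m,(1+\varepsilon)\frac1m\right]$. That is, the law of the output is $(1-t)D+tR$, where $D$ is such a distribution on the hyperedges, $0\le t\le\min\{1,n^{-cd}\}$, and $R$ is an arbitrary distribution on the subsets of $U$. (For $n=0$, where $\mathcal H$ has no hyperedges, read $\log n=0$ and $1/n^{cd}=0$.) -/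

import Mathlib

namespace Hypergraph

variable {V : Type}

/-- Every hyperedge has exactly `d` vertices. -/
def IsUniform (H : Hypergraph V) (d : ℕ) : Prop :=
  ∀ e ∈ H.edgeSet, e.ncard = d

/-- `m(H)`, the number of hyperedges. -/
noncomputable def numEdges (H : Hypergraph V) : ℕ :=
  H.edgeSet.ncard

/-- `m(A₁, …, A_d)`, the number of hyperedges with exactly one vertex in each `A i`. -/
noncomputable def numColorful (H : Hypergraph V) {d : ℕ} (A : Fin d → Set V) : ℕ :=
  {e ∈ H.edgeSet | ∀ i, (e ∩ A i).ncard = 1}.ncard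

open Classical in
/-- The answer of the colorful independent set oracle to the query `A₁, …, A_d`. -/
noncomputable def cid (H : Hypergraph V) {d : ℕ} (A : Fin d → Set V) : Bool :=
  decide (H.numColorful A ≠ 0)

end Hypergraph

/-- Randomized algorithms with colorful independent set (CID) query access to a hypergraph on the
vertex type `V`, with results in `α`: such an algorithm stops with a result, or queries `d`
pairwise disjoint vertex sets and continues according to the answer, or draws from a probability
distribution of its own choice and continues according to the value drawn. -/
inductive CIDAlgorithm (V : Type) (d : ℕ) (α : Type) : Type 1
  | output (a : α) : CIDAlgorithm V d α
  | query (A : Fin d → Set V) (disj : ∀ i j, i ≠ j → Disjoint (A i) (A j))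
      (next : Bool → CIDAlgorithm V d α) : CIDAlgorithm V d α
  | draw {β : Type} (p : PMF β) (next : β → CIDAlgorithm V d α) : CIDAlgorithm V d α

namespace CIDAlgorithm

variable {V : Type} {d : ℕ} {α : Type}

/-- The distribution of the result when the queries are answered by the CID oracle of `H`. -/
noncomputable def law (H : Hypergraph V) : CIDAlgorithm V d α → PMF α
  | output a => PMF.pure a
  | query A _ next => law H (next (H.cid A))
  | draw p next => p.bind fun x => law H (next x)

/-- In the worst case, over the answers and over the random draws, at most `N` queries are made. -/
def QueriesAtMost : CIDAlgorithm V d α → ℕ → Prop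
  | output _, _ => True
  | query _ _ next, N => 1 ≤ N ∧ ∀ b, QueriesAtMost (next b) (N - 1)
  | draw p next, N => ∀ x ∈ p.support, QueriesAtMost (next x) N

/-- With probability at least `1 - δ` the algorithm outputs a `(1 ± ε)`-approximation of the number
of hyperedges, for every `d`-uniform hypergraph with vertex set `V`. -/
def EstimatesHyperedges (alg : CIDAlgorithm V d ℝ) (ε δ : ℝ) : Prop :=
  ∀ H : Hypergraph V, H.vertexSet = Set.univ → H.IsUniform d →
    ENNReal.ofReal (1 - δ) ≤
      (alg.law H).toOuterMeasure {x : ℝ | |(H.numEdges : ℝ) - x| ≤ ε * (H.numEdges : ℝ)}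

/-- With probability at least `1 - δ` the algorithm reports a sample from a distribution `D` on
hyperedges in which every hyperedge has probability in `[(1 - ε) / m, (1 + ε) / m]`, for every
`d`-uniform hypergraph with vertex set `V` and at least one hyperedge. That is, the law of its
output is `(1 - t) D + t R`, where `t ≤ δ` is the failure probability and `R` is arbitrary. -/
def SamplesHyperedges (alg : CIDAlgorithm V d (Set V)) (ε δ : ℝ) : Prop :=
  ∀ H : Hypergraph V, H.vertexSet = Set.univ → H.IsUniform d → H.edgeSet.Nonempty →
    ∃ (D R : PMF (Set V)) (t : ℝ), 0 ≤ t ∧ t ≤ 1 ∧ t ≤ δ ∧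
      D.support ⊆ H.edgeSet ∧
      (∀ e ∈ H.edgeSet, (D e).toReal ∈
        Set.Icc ((1 - ε) * (1 / (H.numEdges : ℝ))) ((1 + ε) * (1 / (H.numEdges : ℝ)))) ∧
      ∀ e, (alg.law H e).toReal = (1 - t) * (D e).toReal + t * (R e).toReal

end CIDAlgorithm

/-!
The number of hyperedges is estimated through their `d !` injective enumerations `t : Fin d → V`.
Numbering the vertices by `0, …, n - 1` and cutting the range of numbers into dyadic intervals
organises the enumerations into a tree of depth `L ≈ log₂ n` with branching `2 ^ d`: a node is a
`Hypergraph.cell`, which prescribes an interval for each coordinate. All that is known about a cell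
comes from CID queries, and the argument has three layers.

*Coarse estimates.* A random colouring of the vertices makes the sets of a query disjoint, and
thinning coordinate `j` to density `2 ^ (-q j)` gives a random query for a cell `F`, answered by Yes
with some probability `P q`. A union bound gives `2 ^ (∑ q) * P q ≤ |F|`
(`Hypergraph.pow_mul_yesProb_le`). Conversely, an induction on `d` shows that the sum of
`2 ^ (∑ q) * P q` over all `q` with `2 ^ (∑ q) ≤ |F|` is at least a constant times `|F|`
(`card_le_sum_hit`), so one of the `(L + 1) ^ d` choices of `q` has
`2 ^ (∑ q) * P q ≥ |F| / Q` and `P q ≥ 1 / Q` for `Q = (4 * d * (L + 1)) ^ d`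
(`Hypergraph.exists_density`). Testing by majority votes which `q` have `P q ≳ 1 / j` therefore
approximates `|F|` up to a factor `80 * Q`. The random seeds are drawn once and are good for all
cells at the same time (`CIDAlgorithm.toOuterMeasure_not_goodSeeds_le`); after that the coarse
estimates are deterministic.

*Counting.* The particle filter `CIDAlgorithm.filterAlg` descends through the tree with `k` weighted
cells, drawing the next `k` cells with probabilities proportional to weight times coarse estimate.
It is unbiased, and each level increases the second moment by a factor of at most `1 + 80 * Q / k`
(`CIDAlgorithm.filterAlg_moments`). Hence `k ≈ Q * L / ε ^ 2` particles suffice for Chebyshev's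
inequality, and `O(d ^ 2 * L)` repetitions amplify the probability of success. This uses about
`L ^ (3 * d + 4) / ε ^ 2` queries.

*Sampling.* A random descent through the tree, with accurate estimates of the sizes of the children
at every step, ends in every enumeration with nearly the same probability. Conditioning every step
on its estimates being accurate gives a distribution `D` on the enumerations with the required
bounds, and the law of the output is at least `(1 - δ) * D` for the total failure probability `δ`
(`CIDAlgorithm.exists_walkAlg_near`); so it is a mixture of `D` with another distribution
(`PMF.exists_mixture`). The relative error `ε / L` and the additional `L` rounds cost a factor
`L ^ 3`.
-/

open scoped ENNReal NNReal

/-! ### Expectations and independent draws for probability mass functions -/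

namespace PMF

variable {α β : Type}

/-- The expectation of a function with values in `[0, ∞]`. -/
noncomputable def expect (p : PMF α) (f : α → ℝ≥0∞) : ℝ≥0∞ := ∑' a, p a * f a

lemma expect_pure (a : α) (f : α → ℝ≥0∞) : (PMF.pure a).expect f = f a := by
  rw [expect, tsum_eq_single a]
  · simp
  · intro b hb
    simp [PMF.pure_apply, hb]

lemma expect_bind (p : PMF α) (g : α → PMF β) (f : β → ℝ≥0∞) :
    (p.bind g).expect f = p.expect fun a => (g a).expect f := by
  simp only [expect, PMF.bind_apply, ← ENNReal.tsum_mul_right, ← ENNReal.tsum_mul_left]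
  rw [ENNReal.tsum_comm]
  simp only [mul_assoc]

lemma expect_map (p : PMF α) (g : α → β) (f : β → ℝ≥0∞) :
    (p.map g).expect f = p.expect fun a => f (g a) := by
  simp [PMF.map, expect_bind, expect_pure]

lemma expect_mono (p : PMF α) {f g : α → ℝ≥0∞} (h : ∀ a, p a ≠ 0 → f a ≤ g a) :
    p.expect f ≤ p.expect g := by
  refine ENNReal.tsum_le_tsum fun a => ?_
  by_cases ha : p a = 0
  · simp [ha]
  · gcongr
    exact h a ha

lemma expect_congr (p : PMF α) {f g : α → ℝ≥0∞} (h : ∀ a, p a ≠ 0 → f a = g a) :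
    p.expect f = p.expect g :=
  le_antisymm (p.expect_mono fun a ha => (h a ha).le) (p.expect_mono fun a ha => (h a ha).ge)

lemma expect_const (p : PMF α) (x : ℝ≥0∞) : p.expect (fun _ => x) = x := by
  rw [expect, ENNReal.tsum_mul_right, p.tsum_coe, one_mul]

lemma expect_add (p : PMF α) (f g : α → ℝ≥0∞) :
    p.expect (fun a => f a + g a) = p.expect f + p.expect g := by
  simp only [expect, mul_add, ENNReal.tsum_add]

lemma expect_const_mul (p : PMF α) (x : ℝ≥0∞) (f : α → ℝ≥0∞) :
    p.expect (fun a => x * f a) = x * p.expect f := by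
  simp only [expect, ← ENNReal.tsum_mul_left, mul_left_comm]

lemma expect_mul_const (p : PMF α) (x : ℝ≥0∞) (f : α → ℝ≥0∞) :
    p.expect (fun a => f a * x) = p.expect f * x := by
  simp only [mul_comm _ x, expect_const_mul]

lemma expect_finsetSum {ι : Type} (p : PMF α) (s : Finset ι) (f : ι → α → ℝ≥0∞) :
    p.expect (fun a => ∑ i ∈ s, f i a) = ∑ i ∈ s, p.expect (f i) := by
  classical
  induction s using Finset.induction_on with
  | empty => simp [expect]
  | insert i s hi ih => simp only [Finset.sum_insert hi, expect_add, ih]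

lemma expect_fintype [Fintype α] (p : PMF α) (f : α → ℝ≥0∞) :
    p.expect f = ∑ a, p a * f a := tsum_fintype _

lemma toOuterMeasure_eq_expect (p : PMF α) (s : Set α) :
    p.toOuterMeasure s = p.expect (s.indicator 1) := by
  rw [PMF.toOuterMeasure_apply, expect]
  refine tsum_congr fun a => ?_
  by_cases ha : a ∈ s <;> simp [ha]

lemma toOuterMeasure_add_compl (p : PMF α) (s : Set α) :
    p.toOuterMeasure s + p.toOuterMeasure sᶜ = 1 := by
  rw [toOuterMeasure_eq_expect, toOuterMeasure_eq_expect, ← expect_add, ← p.expect_const 1]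
  congr 1
  funext a
  by_cases ha : a ∈ s <;> simp [ha]

lemma toOuterMeasure_le_one (p : PMF α) (s : Set α) : p.toOuterMeasure s ≤ 1 :=
  (p.toOuterMeasure_add_compl s) ▸ le_self_add

lemma one_sub_le_toOuterMeasure (p : PMF α) {s : Set α} {δ : ℝ≥0∞}
    (h : p.toOuterMeasure sᶜ ≤ δ) : 1 - δ ≤ p.toOuterMeasure s := by
  rw [tsub_le_iff_right, ← p.toOuterMeasure_add_compl s]
  gcongr

/-- Markov's inequality. -/
lemma mul_toOuterMeasure_le_expect (p : PMF α) {s : Set α} {x : ℝ≥0∞} {f : α → ℝ≥0∞}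
    (h : ∀ a ∈ s, x ≤ f a) : x * p.toOuterMeasure s ≤ p.expect f := by
  rw [toOuterMeasure_eq_expect, ← expect_const_mul]
  refine p.expect_mono fun a _ => ?_
  by_cases ha : a ∈ s
  · simpa [ha] using h a ha
  · simp [ha]

/-- A failure that is unlikely after every good first draw is unlikely overall, up to the
probability of a bad first draw. -/
lemma toOuterMeasure_bind_le (p : PMF α) (g : α → PMF β) (s : Set β) (good : Set α)
    {δ₁ δ₂ : ℝ≥0∞} (h₁ : p.toOuterMeasure goodᶜ ≤ δ₁)
    (h₂ : ∀ a ∈ good, (g a).toOuterMeasure s ≤ δ₂) :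
    (p.bind g).toOuterMeasure s ≤ δ₁ + δ₂ := by
  rw [toOuterMeasure_eq_expect, expect_bind]
  calc _ ≤ p.expect (fun a => goodᶜ.indicator 1 a + δ₂) := by
        refine p.expect_mono fun a _ => ?_
        rw [← toOuterMeasure_eq_expect]
        by_cases ha : a ∈ good
        · simpa [ha] using h₂ a ha
        · simpa [ha] using ((g a).toOuterMeasure_le_one s).trans le_self_add
    _ = p.toOuterMeasure goodᶜ + δ₂ := by
        rw [expect_add, expect_const, toOuterMeasure_eq_expect]
    _ ≤ _ := by gcongr

/-- The law of independent draws from `p 0, p 1, …`. -/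
noncomputable def indep : {n : ℕ} → (Fin n → PMF α) → PMF (Fin n → α)
  | 0, _ => PMF.pure Fin.elim0
  | _ + 1, p => (p 0).bind fun x => (indep fun i => p i.succ).map fun xs => Fin.cons x xs

lemma expect_indep_succ {n : ℕ} (p : Fin (n + 1) → PMF α) (f : (Fin (n + 1) → α) → ℝ≥0∞) :
    (indep p).expect f =
      (p 0).expect fun x => (indep fun i => p i.succ).expect fun xs => f (Fin.cons x xs) := by
  rw [indep, expect_bind]
  simp only [expect_map]

lemma expect_indep_zero (p : Fin 0 → PMF α) (f : (Fin 0 → α) → ℝ≥0∞) :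
    (indep p).expect f = f Fin.elim0 := expect_pure _ _

lemma indep_pure {n : ℕ} (x : Fin n → α) : indep (fun i => PMF.pure (x i)) = PMF.pure x := by
  induction n with
  | zero =>
    rw [indep]
    congr 1
    exact Subsingleton.elim _ _
  | succ n ih =>
    rw [indep, PMF.pure_bind, ih, PMF.pure_map]
    congr 1
    exact Fin.cons_self_tail x

lemma expect_indep_prod {n : ℕ} (p : Fin n → PMF α) (g : Fin n → α → ℝ≥0∞) :
    (indep p).expect (fun x => ∏ i, g i (x i)) = ∏ i, (p i).expect (g i) := by
  induction n with
  | zero => simp [expect_indep_zero]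
  | succ n ih =>
    simp only [expect_indep_succ, Fin.prod_univ_succ, Fin.cons_zero, Fin.cons_succ,
      expect_const_mul, expect_mul_const, ih]

lemma expect_indep_apply {n : ℕ} (p : Fin n → PMF α) (i : Fin n) (g : α → ℝ≥0∞) :
    (indep p).expect (fun x => g (x i)) = (p i).expect g := by
  have h := expect_indep_prod p (fun j => if j = i then g else fun _ => 1)
  rw [Finset.prod_eq_single i (fun j _ hj => by simp [hj, expect_const]) (by simp)] at h
  simp only [if_true] at h
  rw [← h]
  congr 1
  funext x
  rw [Finset.prod_eq_single i (fun j _ hj => by simp [hj]) (by simp)]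
  simp

lemma expect_indep_sum {n : ℕ} (p : Fin n → PMF α) (g : Fin n → α → ℝ≥0∞) :
    (indep p).expect (fun x => ∑ i, g i (x i)) = ∑ i, (p i).expect (g i) := by
  rw [expect_finsetSum]
  simp only [expect_indep_apply]

/-- The second moment of a sum of independent copies: the variance is at most the sum of the second
moments of the summands. -/
lemma expect_iid_sum_sq_le {n : ℕ} (p : PMF α) (g : α → ℝ≥0∞) :
    (indep fun _ : Fin n => p).expect (fun x => (∑ i, g (x i)) ^ 2) ≤
      n * p.expect (fun a => g a ^ 2) + (n * p.expect g) ^ 2 := by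
  induction n with
  | zero => simp [expect_indep_zero]
  | succ n ih =>
    have key : (indep fun _ : Fin (n + 1) => p).expect (fun x => (∑ i, g (x i)) ^ 2) =
        p.expect (fun a => g a ^ 2) + 2 * p.expect g * (n * p.expect g) +
          (indep fun _ : Fin n => p).expect (fun x => (∑ i, g (x i)) ^ 2) := by
      have hs := expect_indep_sum (fun _ : Fin n => p) (fun _ => g)
      simp only [Finset.sum_const, Finset.card_univ, Fintype.card_fin, nsmul_eq_mul] at hs
      simp only [expect_indep_succ, Fin.sum_univ_succ, Fin.cons_zero, Fin.cons_succ, add_sq,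
        expect_add, expect_const_mul, expect_const, hs, expect_mul_const]
    rw [key]
    calc _ ≤ p.expect (fun a => g a ^ 2) + 2 * p.expect g * (n * p.expect g) +
          (n * p.expect (fun a => g a ^ 2) + (n * p.expect g) ^ 2) := by gcongr
      _ ≤ p.expect (fun a => g a ^ 2) + 2 * p.expect g * (n * p.expect g) +
          (n * p.expect (fun a => g a ^ 2) + (n * p.expect g) ^ 2) + p.expect g ^ 2 := le_self_add
      _ = _ := by push_cast; ring

open Classical in
/-- If every draw is bad with probability at most `1 / 16`, then at least half of `n` independent
draws are bad with probability at most `2⁻ⁿ`. -/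
lemma toOuterMeasure_iid_majority_le {n : ℕ} (p : PMF α) {bad : Set α}
    (h : p.toOuterMeasure bad ≤ 1 / 16) :
    (indep fun _ : Fin n => p).toOuterMeasure
      {x | n ≤ 2 * (Finset.univ.filter fun i => x i ∈ bad).card} ≤ (1 / 2) ^ n := by
  -- Markov's inequality for `16 ^ #bad`, whose expectation is at most `2 ^ n`.
  set g : α → ℝ≥0∞ := fun a => if a ∈ bad then 16 else 1 with hg
  have hE : p.expect g ≤ 2 := by
    calc p.expect g ≤ p.expect (fun a => 1 + 16 * bad.indicator 1 a) := by
          refine p.expect_mono fun a _ => ?_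
          by_cases ha : a ∈ bad <;> simp [hg, ha]
      _ = 1 + 16 * p.toOuterMeasure bad := by
          rw [expect_add, expect_const, expect_const_mul, toOuterMeasure_eq_expect]
      _ ≤ 1 + 16 * (1 / 16) := by gcongr
      _ = 2 := by
          rw [ENNReal.mul_div_cancel (by norm_num) (by norm_num)]
          norm_num
  have hprod : (indep fun _ : Fin n => p).expect (fun x => ∏ i, g (x i)) ≤ 2 ^ n := by
    rw [expect_indep_prod]
    simpa using pow_le_pow_left' hE n
  have hM := (mul_toOuterMeasure_le_expect (indep fun _ : Fin n => p) (x := 4 ^ n)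
    (s := {x | n ≤ 2 * (Finset.univ.filter fun i => x i ∈ bad).card})
    (f := fun x => ∏ i, g (x i)) (by
      intro x hx
      simp only [hg, Finset.prod_ite, Finset.prod_const, one_pow, mul_one]
      calc (4 : ℝ≥0∞) ^ n ≤ 4 ^ (2 * (Finset.univ.filter fun i => x i ∈ bad).card) :=
            pow_le_pow_right₀ (by norm_num) hx
        _ = _ := by rw [pow_mul]; norm_num)).trans hprod
  have h4 : (4 : ℝ≥0∞) ^ n = 2 ^ n * 2 ^ n := by rw [← mul_pow]; norm_num
  rw [h4, mul_assoc] at hM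
  have h2 : (2 : ℝ≥0∞) ^ n ≠ 0 := by positivity
  have h2' : (2 : ℝ≥0∞) ^ n ≠ ⊤ := ENNReal.pow_ne_top (by norm_num)
  have hM' : (2 : ℝ≥0∞) ^ n * (2 ^ n * (indep fun _ : Fin n => p).toOuterMeasure
      {x | n ≤ 2 * (Finset.univ.filter fun i => x i ∈ bad).card}) ≤ 2 ^ n * 1 := by simpa using hM
  rw [ENNReal.mul_le_mul_iff_right h2 h2'] at hM'
  rw [one_div, ← ENNReal.inv_pow, ENNReal.le_inv_iff_mul_le, mul_comm]
  exact hM'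

/-- Chebyshev's inequality, for a nonnegative estimator with known mean. -/
lemma toOuterMeasure_deviation_le (p : PMF α) (Z : α → ℝ≥0) (M η v : ℝ≥0) (hη : 0 < η)
    (hmean : p.expect (fun a => (Z a : ℝ≥0∞)) = M)
    (hsq : p.expect (fun a => (Z a : ℝ≥0∞) ^ 2) ≤ ((1 + v) * M ^ 2 : ℝ≥0)) :
    p.toOuterMeasure {a | ¬ |(Z a : ℝ) - M| ≤ η * M} ≤ (v / η ^ 2 : ℝ≥0) := by
  have hvar : p.expect (fun a => ENNReal.ofReal (((Z a : ℝ) - M) ^ 2)) ≤ (v * M ^ 2 : ℝ≥0) := by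
    have hid : p.expect (fun a => ENNReal.ofReal (((Z a : ℝ) - M) ^ 2)) + 2 * M * M ≤
        (1 + v) * M ^ 2 + M ^ 2 := by
      calc _ = p.expect (fun a => ENNReal.ofReal (((Z a : ℝ) - M) ^ 2) + 2 * M * Z a) := by
            rw [expect_add, expect_const_mul, hmean]
        _ = p.expect (fun a => (Z a : ℝ≥0∞) ^ 2 + (M : ℝ≥0∞) ^ 2) := by
            congr 1
            funext a
            have : (2 * M * Z a : ℝ≥0∞) = ENNReal.ofReal (2 * M * Z a) := by
              rw [ENNReal.ofReal_mul (by positivity), ENNReal.ofReal_mul (by positivity)]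
              simp
            rw [this, ← ENNReal.ofReal_add (by positivity) (by positivity)]
            rw [show ((Z a : ℝ) - M) ^ 2 + 2 * M * Z a = (Z a : ℝ) ^ 2 + (M : ℝ) ^ 2 by ring,
              ENNReal.ofReal_add (by positivity) (by positivity), ENNReal.ofReal_pow (by positivity),
              ENNReal.ofReal_pow (by positivity)]
            simp
        _ ≤ _ := by
            rw [expect_add, expect_const]
            gcongr
            simpa using hsq
    have hid' : p.expect (fun a => ENNReal.ofReal (((Z a : ℝ) - M) ^ 2)) + (2 * M * M : ℝ≥0) ≤
        (v * M ^ 2 : ℝ≥0) + (2 * M * M : ℝ≥0) := by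
      calc _ = p.expect (fun a => ENNReal.ofReal (((Z a : ℝ) - M) ^ 2)) + 2 * M * M := by
            push_cast; rfl
        _ ≤ _ := hid
        _ = _ := by push_cast; ring
    exact (ENNReal.add_le_add_iff_right ENNReal.coe_ne_top).1 hid'
  rcases eq_or_ne M 0 with rfl | hM
  · -- With mean zero the estimator vanishes almost surely.
    have h0 : p.toOuterMeasure {a | ¬ |(Z a : ℝ) - (0 : ℝ≥0)| ≤ η * (0 : ℝ≥0)} = 0 := by
      rw [PMF.toOuterMeasure_apply_eq_zero_iff, Set.disjoint_left]
      intro a ha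
      have := ENNReal.tsum_eq_zero.1 (show ∑' a, p a * (Z a : ℝ≥0∞) = 0 by simpa [expect] using hmean) a
      rcases mul_eq_zero.1 this with h | h
      · exact absurd h ((p.mem_support_iff a).1 ha)
      · have : Z a = 0 := by exact_mod_cast h
        simp [this]
    rw [h0]
    exact zero_le
  · have hM' : 0 < M := pos_iff_ne_zero.2 hM
    have hmk := (mul_toOuterMeasure_le_expect p (x := ((η * M) ^ 2 : ℝ≥0))
      (s := {a | ¬ |(Z a : ℝ) - M| ≤ η * M})
      (f := fun a => ENNReal.ofReal (((Z a : ℝ) - M) ^ 2)) (by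
        intro a ha
        rw [← ENNReal.ofReal_coe_nnreal]
        refine ENNReal.ofReal_le_ofReal ?_
        have ha' : (η * M : ℝ) < |(Z a : ℝ) - M| := not_le.1 ha
        rw [← sq_abs ((Z a : ℝ) - M)]
        push_cast
        exact pow_le_pow_left₀ (by positivity) ha'.le 2)).trans hvar
    have hne : (η * M) ^ 2 ≠ 0 := by positivity
    have hq : (v / η ^ 2 : ℝ≥0) = (v * M ^ 2) / (η * M) ^ 2 := by
      field_simp
    rw [hq, ENNReal.coe_div hne, ENNReal.le_div_iff_mul_le (Or.inl (by exact_mod_cast hne))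
      (Or.inl ENNReal.coe_ne_top), mul_comm]
    exact hmk

end PMF

/-! ### Composing query algorithms -/

namespace CIDAlgorithm

variable {V : Type} {d : ℕ} {α β ι : Type}

/-- Run an algorithm and continue with its result. -/
noncomputable def bind : CIDAlgorithm V d α → (α → CIDAlgorithm V d β) → CIDAlgorithm V d β
  | output a, f => f a
  | query A h next, f => query A h fun b => (next b).bind f
  | draw p next, f => draw p fun x => (next x).bind f

lemma law_bind (H : Hypergraph V) (a : CIDAlgorithm V d α) (f : α → CIDAlgorithm V d β) :
    (a.bind f).law H = (a.law H).bind fun x => (f x).law H := by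
  induction a with
  | output a => simp [bind, law]
  | query A h next ih => simp [bind, law, ih]
  | draw p next ih => simp [bind, law, ih, PMF.bind_bind]

lemma QueriesAtMost.mono {a : CIDAlgorithm V d α} {N N' : ℕ} (h : a.QueriesAtMost N)
    (hN : N ≤ N') : a.QueriesAtMost N' := by
  induction a generalizing N N' with
  | output a => trivial
  | query A hA next ih => exact ⟨h.1.trans hN, fun b => ih b (h.2 b) (by omega)⟩
  | draw p next ih => exact fun x hx => ih x (h x hx) hN

lemma QueriesAtMost.bind {a : CIDAlgorithm V d α} {f : α → CIDAlgorithm V d β} {N N' : ℕ}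
    (h : a.QueriesAtMost N) (hf : ∀ x, (f x).QueriesAtMost N') :
    (a.bind f).QueriesAtMost (N + N') := by
  induction a generalizing N with
  | output a => exact (hf a).mono (by omega)
  | query A hA next ih =>
    refine ⟨h.1.trans (by omega), fun b => ?_⟩
    have := ih b (h.2 b)
    rwa [show N + N' - 1 = N - 1 + N' by have := h.1; omega]
  | draw p next ih => exact fun x hx => ih x (h x hx)

/-- Run finitely many algorithms, with independent random draws. -/
noncomputable def seq : {n : ℕ} → (Fin n → CIDAlgorithm V d α) → CIDAlgorithm V d (Fin n → α)
  | 0, _ => output Fin.elim0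
  | _ + 1, a => (a 0).bind fun x => (seq fun i => a i.succ).bind fun xs => output (Fin.cons x xs)

lemma law_seq (H : Hypergraph V) {n : ℕ} (a : Fin n → CIDAlgorithm V d α) :
    (seq a).law H = PMF.indep fun i => (a i).law H := by
  induction n with
  | zero => rfl
  | succ n ih => simp [seq, PMF.indep, law_bind, ih, law, PMF.map, Function.comp_def]

lemma QueriesAtMost.seq {n : ℕ} {a : Fin n → CIDAlgorithm V d α} {N : ℕ}
    (h : ∀ i, (a i).QueriesAtMost N) : (seq a).QueriesAtMost (n * N) := by
  induction n with
  | zero => trivial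
  | succ n ih =>
    refine ((h 0).bind (N' := n * N) fun x => ?_).mono (by rw [add_mul]; omega)
    exact (ih fun i => h i.succ).bind (N' := 0) fun _ => trivial

/-- Run a finite family of algorithms, with independent random draws. -/
noncomputable def family [Fintype ι] (a : ι → CIDAlgorithm V d α) : CIDAlgorithm V d (ι → α) :=
  (seq fun i => a ((Fintype.equivFin ι).symm i)).bind fun x =>
    output fun i => x (Fintype.equivFin ι i)

lemma law_family_pure [Fintype ι] (H : Hypergraph V) {a : ι → CIDAlgorithm V d α} {x : ι → α}
    (h : ∀ i, (a i).law H = PMF.pure (x i)) : (family a).law H = PMF.pure x := by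
  simp [family, law_bind, law_seq, h, PMF.indep_pure, law]

lemma law_family_coord [Fintype ι] (H : Hypergraph V) (a : ι → CIDAlgorithm V d α) (i : ι)
    (s : Set α) :
    ((family a).law H).toOuterMeasure {x | x i ∈ s} = ((a i).law H).toOuterMeasure s := by
  have h := PMF.expect_indep_apply (fun j => (a ((Fintype.equivFin ι).symm j)).law H)
    (Fintype.equivFin ι i) (s.indicator 1)
  rw [Equiv.symm_apply_apply] at h
  rw [PMF.toOuterMeasure_eq_expect, PMF.toOuterMeasure_eq_expect, ← h, family, law_bind,
    PMF.expect_bind, law_seq]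
  simp only [law, PMF.expect_pure]
  rfl

lemma QueriesAtMost.family [Fintype ι] {a : ι → CIDAlgorithm V d α} {N : ℕ}
    (h : ∀ i, (a i).QueriesAtMost N) : (family a).QueriesAtMost (Fintype.card ι * N) :=
  (QueriesAtMost.seq fun _ => h _).bind (N' := 0) fun _ => trivial

/-- A single query. -/
def ask (A : Fin d → Set V) (disj : ∀ i j, i ≠ j → Disjoint (A i) (A j)) :
    CIDAlgorithm V d Bool :=
  query A disj output

lemma law_ask (H : Hypergraph V) (A : Fin d → Set V)
    (disj : ∀ i j, i ≠ j → Disjoint (A i) (A j)) :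
    (ask A disj).law H = PMF.pure (H.cid A) := rfl

lemma queriesAtMost_ask (A : Fin d → Set V) (disj : ∀ i j, i ≠ j → Disjoint (A i) (A j)) :
    (ask A disj).QueriesAtMost 1 := ⟨le_rfl, fun _ => trivial⟩

end CIDAlgorithm

/-! ### Random vertex sets and how often they hit a set of tuples -/

namespace PMF

variable {α V : Type} [Fintype V]

/-- Independent labels with law `p` on the elements of a finite type. -/
noncomputable def labelling (p : PMF α) : PMF (V → α) :=
  (indep fun _ : Fin (Fintype.card V) => p).map fun x v => x (Fintype.equivFin V v)

lemma expect_labelling_prod (p : PMF α) (g : V → α → ℝ≥0∞) :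
    (labelling p).expect (fun x => ∏ v, g v (x v)) = ∏ v, p.expect (g v) := by
  rw [labelling, expect_map]
  have h := expect_indep_prod (fun _ => p) (fun i => g ((Fintype.equivFin V).symm i))
  rw [(Fintype.equivFin V).symm.prod_comp (fun v => p.expect (g v))] at h
  rw [← h]
  congr 1
  funext x
  rw [← (Fintype.equivFin V).symm.prod_comp]
  simp

lemma toOuterMeasure_uniform_lt {L q : ℕ} (hq : q ≤ L) :
    (PMF.uniformOfFintype (Fin (2 ^ L))).toOuterMeasure {x | (x : ℕ) < 2 ^ (L - q)} =
      (2 ^ q)⁻¹ := by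
  classical
  have hpow : 2 ^ (L - q) * 2 ^ q = 2 ^ L := by rw [← pow_add]; congr 1; omega
  rw [PMF.toOuterMeasure_uniformOfFintype_apply]
  have hc : Fintype.card {x : Fin (2 ^ L) | (x : ℕ) < 2 ^ (L - q)} = 2 ^ (L - q) := by
    refine (Fintype.card_subtype _).trans ?_
    refine (Fin.card_filter_val_lt).trans ?_
    exact min_eq_right (Nat.pow_le_pow_right (by norm_num) (by omega))
  rw [hc, Fintype.card_fin, ← hpow]
  push_cast
  rw [ENNReal.div_eq_inv_mul, ENNReal.mul_inv (Or.inl (by positivity))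
    (Or.inl (ENNReal.pow_ne_top (by norm_num))), mul_right_comm,
    ENNReal.inv_mul_cancel (by positivity) (ENNReal.pow_ne_top (by norm_num)), one_mul]

/-- At the density `2 ^ (-q)` for which `2 ^ q ≤ |G| < 2 ^ (q + 1)`, a random vertex set hits
`G` with probability at least `1 / 2`. -/
lemma card_le_hit {L : ℕ} (G : Finset V) (hG : G.Nonempty) (hL : Nat.log 2 G.card ≤ L) :
    (G.card : ℝ≥0∞) ≤ 4 * (2 ^ Nat.log 2 G.card *
      (labelling (PMF.uniformOfFintype (Fin (2 ^ L)))).toOuterMeasure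
        {h : V → Fin (2 ^ L) | ∃ x ∈ G, (h x : ℕ) < 2 ^ (L - Nat.log 2 G.card)}) := by
  classical
  set q := Nat.log 2 G.card with hq
  set p := PMF.uniformOfFintype (Fin (2 ^ L))
  set S : Set (Fin (2 ^ L)) := {x | (x : ℕ) < 2 ^ (L - q)} with hS
  have hcard : G.card ≠ 0 := Finset.card_ne_zero.2 hG
  have hlow : 2 ^ q ≤ G.card := Nat.pow_log_le_self 2 hcard
  have hhigh : G.card < 2 ^ (q + 1) := Nat.lt_pow_succ_log_self (by norm_num) _
  have hcompl : p.toOuterMeasure Sᶜ = ENNReal.ofReal (1 - (2 ^ q)⁻¹) := by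
    have h1 := p.toOuterMeasure_add_compl S
    rw [hS, toOuterMeasure_uniform_lt hL, ← hS] at h1
    have h2 : ((2 : ℝ≥0∞) ^ q)⁻¹ = ENNReal.ofReal ((2 ^ q)⁻¹) := by
      rw [ENNReal.ofReal_inv_of_pos (by positivity), ENNReal.ofReal_pow (by norm_num)]
      simp
    have h3 : (1 : ℝ≥0∞) = ENNReal.ofReal ((2 ^ q)⁻¹) + ENNReal.ofReal (1 - (2 ^ q)⁻¹) := by
      rw [← ENNReal.ofReal_add (by positivity)]
      · simp
      · rw [sub_nonneg]
        exact inv_le_one_of_one_le₀ (one_le_pow₀ (by norm_num))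
    rw [h2] at h1
    exact (ENNReal.add_right_inj ENNReal.ofReal_ne_top).1 (h1.trans h3)
  have hmiss : (labelling p).toOuterMeasure {h : V → Fin (2 ^ L) | ∃ x ∈ G, h x ∈ S}ᶜ ≤ 1 / 2 := by
    have hprod := expect_labelling_prod (V := V) p
      (fun v => if v ∈ G then Sᶜ.indicator 1 else fun _ => 1)
    have heq : ∏ v, p.expect (if v ∈ G then Sᶜ.indicator 1 else fun _ => 1) =
        ENNReal.ofReal (1 - (2 ^ q)⁻¹) ^ G.card := by
      rw [← hcompl, toOuterMeasure_eq_expect, ← Finset.prod_const, ← Finset.prod_subset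
        (Finset.subset_univ G) (by intro v _ hv; simp [hv, expect_const])]
      exact Finset.prod_congr rfl fun v hv => by simp [hv]
    rw [toOuterMeasure_eq_expect]
    have hle : (labelling p).expect ({h : V → Fin (2 ^ L) | ∃ x ∈ G, h x ∈ S}ᶜ.indicator 1) ≤
        ENNReal.ofReal (1 - (2 ^ q)⁻¹) ^ G.card := by
      rw [← heq, ← hprod]
      refine expect_mono _ fun h _ => ?_
      by_cases hh : ∃ x ∈ G, h x ∈ S
      · simp [hh]
      · rw [Finset.prod_eq_one]
        · exact Set.indicator_le_self' (fun _ _ => by simp) h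
        · intro v _
          by_cases hv : v ∈ G
          · have : h v ∉ S := fun hvS => hh ⟨v, hv, hvS⟩
            simp [hv, this]
          · simp [hv]
    refine hle.trans ?_
    have hx : (0 : ℝ) ≤ 1 - (2 ^ q)⁻¹ := by
      rw [sub_nonneg]
      exact inv_le_one_of_one_le₀ (one_le_pow₀ (by norm_num))
    rw [← ENNReal.ofReal_pow hx]
    have hreal : (1 - ((2 : ℝ) ^ q)⁻¹) ^ G.card ≤ 1 / 2 := by
      calc (1 - ((2 : ℝ) ^ q)⁻¹) ^ G.card ≤ (1 - ((2 : ℝ) ^ q)⁻¹) ^ (2 ^ q) :=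
            pow_le_pow_of_le_one hx (by simp) hlow
        _ ≤ Real.exp (-((2 : ℝ) ^ q)⁻¹) ^ (2 ^ q) := by
            gcongr
            exact Real.one_sub_le_exp_neg _
        _ = Real.exp (-1) := by
            rw [← Real.exp_nat_mul]
            congr 1
            push_cast
            field_simp
        _ ≤ 1 / 2 := by
            rw [Real.exp_neg, one_div]
            exact inv_anti₀ (by norm_num) Real.exp_one_gt_two.le
    calc ENNReal.ofReal ((1 - ((2 : ℝ) ^ q)⁻¹) ^ G.card) ≤ ENNReal.ofReal (1 / 2) :=
          ENNReal.ofReal_le_ofReal hreal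
      _ = 1 / 2 := by
          rw [ENNReal.ofReal_div_of_pos (by norm_num)]
          simp
  have hhit := one_sub_le_toOuterMeasure _ hmiss
  have hhalf : (1 : ℝ≥0∞) / 2 ≤
      (labelling p).toOuterMeasure {h : V → Fin (2 ^ L) | ∃ x ∈ G, h x ∈ S} := by
    refine le_trans (le_of_eq ?_) hhit
    rw [one_div, ENNReal.one_sub_inv_two]
  calc (G.card : ℝ≥0∞) ≤ ((2 ^ (q + 1) : ℕ) : ℝ≥0∞) := by exact_mod_cast hhigh.le
    _ = 4 * (2 ^ q * (1 / 2)) := by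
        have h4 : (4 : ℝ≥0∞) = 2 * 2 := by norm_num
        push_cast
        rw [h4, pow_succ, mul_assoc, mul_left_comm 2 (2 ^ q), one_div,
          ENNReal.mul_inv_cancel (by norm_num) (by norm_num), mul_one, mul_comm]
    _ ≤ _ := by gcongr; exact hhalf

end PMF

open PMF in
open Classical in
/-- A set of tuples can be recovered up to constants from how often random boxes hit it: if
`ω` provides random vertex sets `{x | In ω q x}` of density about `2 ^ (-q)`, then the
probabilities that the box with densities `2 ^ (- q j)` hits `F`, weighted by the inverse volumes
of the boxes, add up to at least `|F| / 4 ^ d`; and boxes of inverse volume at most `|F|` suffice.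

By induction on `d`, splitting off the first coordinate. The fibres `G y` over the remaining
coordinates are sorted by `a = log₂ |G y|`, and only the density `2 ^ (-a)` is used on
them. There are at most `|F| / 2 ^ a` such fibres, which provides the bound on the volume. -/
lemma card_le_sum_hit {V Ω : Type} [Fintype V] (p : PMF Ω) (In : Ω → ℕ → V → Prop) (L : ℕ)
    (hL : ∀ G : Finset V, Nat.log 2 G.card ≤ L)
    (hhit : ∀ G : Finset V, G.Nonempty → (G.card : ℝ≥0∞) ≤ 4 * (2 ^ Nat.log 2 G.card *
      p.toOuterMeasure {ω | ∃ x ∈ G, In ω (Nat.log 2 G.card) x}))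
    {d : ℕ} (F : Finset (Fin d → V)) {N : ℕ} (hN : F.card ≤ N) :
    (F.card : ℝ≥0∞) ≤ 4 ^ d * ∑ q : Fin d → Fin (L + 1),
      if 2 ^ (∑ j, (q j : ℕ)) ≤ N then 2 ^ (∑ j, (q j : ℕ)) *
        (indep fun _ : Fin d => p).toOuterMeasure
          {ω | ∃ t ∈ F, ∀ j, In (ω j) (q j) (t j)} else 0 := by
  induction d generalizing N with
  | zero =>
    rcases F.eq_empty_or_nonempty with rfl | ⟨t, ht⟩
    · simp
    · have h1 : F.card = 1 := by
        refine le_antisymm (Finset.card_le_one.2 fun a _ b _ => Subsingleton.elim a b) ?_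
        exact Finset.card_pos.2 ⟨t, ht⟩
      have hset : ∀ q : Fin 0 → Fin (L + 1),
          {ω : Fin 0 → Ω | ∃ t ∈ F, ∀ j, In (ω j) (q j) (t j)} = Set.univ :=
        fun q => Set.eq_univ_of_forall fun ω => ⟨t, ht, fun j => j.elim0⟩
      have huniv : (indep fun _ : Fin 0 => p).toOuterMeasure Set.univ = 1 := by
        simpa using (indep fun _ : Fin 0 => p).toOuterMeasure_add_compl Set.univ
      rw [Fintype.sum_unique, hset, huniv, h1]
      simp [show 1 ≤ N by omega]
  | succ d ih =>
    set G : (Fin d → V) → Finset V := fun y =>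
      Finset.univ.filter fun x => (Fin.cons x y : Fin (d + 1) → V) ∈ F with hG
    set Y : ℕ → Finset (Fin d → V) := fun a =>
      Finset.univ.filter fun y => (G y).Nonempty ∧ Nat.log 2 (G y).card = a with hY
    have hsumG : F.card = ∑ y, (G y).card := by
      rw [Finset.card_eq_sum_card_fiberwise (f := fun t => Fin.tail t) (t := Finset.univ)
        (fun _ _ => Finset.mem_coe.2 (Finset.mem_univ _))]
      refine Finset.sum_congr rfl fun y _ => ?_
      refine Finset.card_nbij' (fun t => t 0) (fun x => Fin.cons x y) ?_ ?_ ?_ ?_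
      · intro t ht
        obtain ⟨ht, rfl⟩ := Finset.mem_filter.1 (Finset.mem_coe.1 ht)
        simpa [hG] using ht
      · intro x hx
        have : (Fin.cons x y : Fin (d + 1) → V) ∈ F := by simpa [hG] using hx
        simp [this]
      · intro t ht
        obtain ⟨ht, rfl⟩ := Finset.mem_filter.1 (Finset.mem_coe.1 ht)
        simp
      · intro x _
        simp
    have hYcard : ∀ a, (Y a).card ≤ N / 2 ^ a := by
      intro a
      rw [Nat.le_div_iff_mul_le (by positivity), ← smul_eq_mul]
      refine le_trans ?_ hN
      rw [hsumG]
      refine le_trans (Finset.card_nsmul_le_sum (Y a) (fun y => (G y).card) (2 ^ a) ?_)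
        (Finset.sum_le_univ_sum_of_nonneg fun _ => Nat.zero_le _)
      intro y hy
      obtain ⟨hne, rfl⟩ := (Finset.mem_filter.1 hy).2
      exact Nat.pow_log_le_self 2 (Finset.card_ne_zero.2 hne)
    set FB : ℕ → Ω → Finset (Fin d → V) := fun a ω =>
      (Y a).filter fun y => ∃ x ∈ G y, In ω a x with hFB
    have hstep : ∀ a : Fin (L + 1), (∑ y ∈ Y a, ((G y).card : ℝ≥0∞)) ≤ 4 ^ (d + 1) *
        ∑ q : Fin d → Fin (L + 1),
          if 2 ^ (∑ j, ((Fin.cons a q : Fin (d + 1) → Fin (L + 1)) j : ℕ)) ≤ N then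
            2 ^ (∑ j, ((Fin.cons a q : Fin (d + 1) → Fin (L + 1)) j : ℕ)) *
              (indep fun _ : Fin (d + 1) => p).toOuterMeasure
                {ω | ∃ t ∈ F, ∀ j, In (ω j)
                  ((Fin.cons a q : Fin (d + 1) → Fin (L + 1)) j) (t j)} else 0 := by
      intro a
      calc (∑ y ∈ Y a, ((G y).card : ℝ≥0∞))
          ≤ ∑ y ∈ Y a, 4 * (2 ^ (a : ℕ) * p.toOuterMeasure {ω | ∃ x ∈ G y, In ω a x}) := by
            refine Finset.sum_le_sum fun y hy => ?_
            obtain ⟨hne, hlog⟩ := (Finset.mem_filter.1 hy).2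
            have := hhit (G y) hne
            rwa [hlog] at this
        _ = 4 * 2 ^ (a : ℕ) * p.expect (fun ω => ((FB a ω).card : ℝ≥0∞)) := by
            rw [← Finset.mul_sum, ← Finset.mul_sum, mul_assoc]
            congr 2
            simp only [toOuterMeasure_eq_expect]
            rw [← expect_finsetSum]
            congr 1
            funext ω
            rw [hFB, Finset.card_filter]
            push_cast
            refine Finset.sum_congr rfl fun y _ => ?_
            simp [Set.indicator_apply]
        _ ≤ 4 * 2 ^ (a : ℕ) * p.expect (fun ω => 4 ^ d * ∑ q : Fin d → Fin (L + 1),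
              if 2 ^ (∑ j, (q j : ℕ)) ≤ N / 2 ^ (a : ℕ) then 2 ^ (∑ j, (q j : ℕ)) *
                (indep fun _ : Fin d => p).toOuterMeasure
                  {ω' | ∃ t ∈ FB a ω, ∀ j, In (ω' j) (q j) (t j)} else 0) := by
            gcongr
            refine expect_mono _ fun ω _ => ih (FB a ω) ?_
            exact (Finset.card_filter_le _ _).trans (hYcard a)
        _ = 4 ^ (d + 1) * ∑ q : Fin d → Fin (L + 1),
              2 ^ (a : ℕ) * p.expect (fun ω =>
                if 2 ^ (∑ j, (q j : ℕ)) ≤ N / 2 ^ (a : ℕ) then 2 ^ (∑ j, (q j : ℕ)) *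
                  (indep fun _ : Fin d => p).toOuterMeasure
                    {ω' | ∃ t ∈ FB a ω, ∀ j, In (ω' j) (q j) (t j)} else 0) := by
            rw [expect_const_mul, expect_finsetSum, ← Finset.mul_sum]
            ring
        _ ≤ _ := by
            gcongr with q
            simp only [Fin.sum_univ_succ, Fin.cons_zero, Fin.cons_succ, pow_add]
            have hiff : 2 ^ (∑ j, (q j : ℕ)) ≤ N / 2 ^ (a : ℕ) ↔
                2 ^ (a : ℕ) * 2 ^ (∑ j, (q j : ℕ)) ≤ N := by
              rw [Nat.le_div_iff_mul_le (by positivity), mul_comm]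
            by_cases hle : 2 ^ (∑ j, (q j : ℕ)) ≤ N / 2 ^ (a : ℕ)
            · simp only [if_pos hle, if_pos (hiff.1 hle)]
              rw [expect_const_mul, mul_assoc]
              gcongr
              rw [toOuterMeasure_eq_expect (indep fun _ : Fin (d + 1) => p), expect_indep_succ]
              refine expect_mono _ fun ω _ => ?_
              rw [toOuterMeasure_eq_expect]
              refine expect_mono _ fun ω' _ => ?_
              by_cases hmem : ω' ∈ {ω' | ∃ t ∈ FB a ω, ∀ j, In (ω' j) (q j) (t j)}
              · obtain ⟨y, hy, hyq⟩ := hmem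
                obtain ⟨x, hx, hxa⟩ := (Finset.mem_filter.1 hy).2
                have hcons : (Fin.cons x y : Fin (d + 1) → V) ∈ F := (Finset.mem_filter.1 hx).2
                refine le_trans (Set.indicator_le_self' (fun _ _ => zero_le) ω') ?_
                rw [Set.indicator_of_mem]
                · exact le_rfl
                refine ⟨_, hcons, fun j => ?_⟩
                refine Fin.cases ?_ (fun i => ?_) j
                · simpa using hxa
                · simpa using hyq i
              · rw [Set.indicator_of_notMem hmem]
                exact zero_le
            · simp only [if_neg hle, if_neg (fun h => hle (hiff.2 h)), expect_const, mul_zero,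
                le_refl]
    calc (F.card : ℝ≥0∞) = ∑ y, ((G y).card : ℝ≥0∞) := by rw [hsumG]; push_cast; rfl
      _ ≤ ∑ a : Fin (L + 1), ∑ y ∈ Y a, ((G y).card : ℝ≥0∞) := by
          simp only [hY, Finset.sum_filter]
          rw [Finset.sum_comm]
          refine Finset.sum_le_sum fun y _ => ?_
          rcases (G y).eq_empty_or_nonempty with h0 | hne
          · simp [h0]
          · refine le_trans (le_of_eq ?_) (Finset.single_le_sum (fun _ _ => zero_le)
              (Finset.mem_univ (⟨Nat.log 2 (G y).card, Nat.lt_succ_of_le (hL _)⟩ : Fin (L + 1))))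
            simp [hne]
      _ ≤ _ := by
          rw [← (Fin.consEquiv fun _ : Fin (d + 1) => Fin (L + 1)).sum_comp, Fintype.sum_prod_type,
            Finset.mul_sum]
          exact Finset.sum_le_sum fun a _ => hstep a

/-! ### Repeated independent trials -/

namespace PMF

variable {α : Type}

lemma toOuterMeasure_iid_exists_lt_le {R : ℕ} (p : PMF α) (S : Set α) (j : ℕ) :
    (indep fun _ : Fin R => p).toOuterMeasure {x | ∃ s : Fin R, (s : ℕ) < j ∧ x s ∈ S} ≤
      j * p.toOuterMeasure S := by
  classical
  set A : Finset (Fin R) := Finset.univ.filter fun s => (s : ℕ) < j with hA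
  have hcard : A.card ≤ j := by
    rw [hA, Fin.card_filter_val_lt]
    exact min_le_right _ _
  rw [toOuterMeasure_eq_expect]
  calc _ ≤ (indep fun _ : Fin R => p).expect (fun x => ∑ s ∈ A, S.indicator 1 (x s)) := by
        refine expect_mono _ fun x _ => ?_
        by_cases hx : ∃ s : Fin R, (s : ℕ) < j ∧ x s ∈ S
        · obtain ⟨s, hs, hxs⟩ := hx
          refine (Set.indicator_le_self' (fun _ _ => zero_le) x).trans ?_
          refine le_trans ?_ (Finset.single_le_sum (fun _ _ => zero_le)
            (show s ∈ A from Finset.mem_filter.2 ⟨Finset.mem_univ _, hs⟩))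
          simp [hxs]
        · rw [Set.indicator_of_notMem (by exact hx)]
          exact zero_le
    _ = A.card * p.toOuterMeasure S := by
        rw [expect_finsetSum]
        simp only [expect_indep_apply (fun _ : Fin R => p), ← toOuterMeasure_eq_expect,
          Finset.sum_const, nsmul_eq_mul]
    _ ≤ _ := by gcongr

lemma toOuterMeasure_iid_not_exists_lt_le {R : ℕ} (p : PMF α) (S : Set α) {j : ℕ} (hj : j ≤ R)
    (h : 4 ≤ j * p.toOuterMeasure S) :
    (indep fun _ : Fin R => p).toOuterMeasure {x | ¬ ∃ s : Fin R, (s : ℕ) < j ∧ x s ∈ S} ≤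
      1 / 16 := by
  classical
  set P := (p.toOuterMeasure S).toReal with hP
  have hPE : p.toOuterMeasure S = ENNReal.ofReal P :=
    (ENNReal.ofReal_toReal (ne_top_of_le_ne_top ENNReal.one_ne_top
      (p.toOuterMeasure_le_one S))).symm
  have hP1 : P ≤ 1 := ENNReal.toReal_le_of_le_ofReal zero_le_one (by
    simpa using p.toOuterMeasure_le_one S)
  have hP0 : 0 ≤ P := ENNReal.toReal_nonneg
  have hjP : 4 ≤ j * P := by
    rw [hPE, ← ENNReal.ofReal_natCast, ← ENNReal.ofReal_mul (by positivity)] at h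
    rw [← ENNReal.ofReal_ofNat] at h
    exact (ENNReal.ofReal_le_ofReal_iff (by positivity)).1 h
  have hno : p.toOuterMeasure Sᶜ = ENNReal.ofReal (1 - P) := by
    have h1 := p.toOuterMeasure_add_compl S
    rw [hPE] at h1
    refine (ENNReal.add_right_inj ENNReal.ofReal_ne_top).1 (h1.trans ?_)
    rw [← ENNReal.ofReal_add hP0 (by linarith)]
    simp
  have hprod := expect_indep_prod (fun _ : Fin R => p)
    (fun s => if (s : ℕ) < j then Sᶜ.indicator 1 else fun _ => 1)
  have heq : ∏ s : Fin R, p.expect (if (s : ℕ) < j then Sᶜ.indicator 1 else fun _ => 1) =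
      ENNReal.ofReal (1 - P) ^ j := by
    have hc : (Finset.univ.filter fun s : Fin R => (s : ℕ) < j).card = j := by
      rw [Fin.card_filter_val_lt]
      exact min_eq_right hj
    calc _ = ∏ s : Fin R, if (s : ℕ) < j then ENNReal.ofReal (1 - P) else 1 := by
          refine Finset.prod_congr rfl fun s _ => ?_
          split_ifs
          · rw [← toOuterMeasure_eq_expect, hno]
          · exact expect_const _ _
      _ = _ := by rw [Finset.prod_ite, Finset.prod_const, Finset.prod_const_one, hc, mul_one]
  rw [toOuterMeasure_eq_expect]
  calc _ ≤ ENNReal.ofReal (1 - P) ^ j := by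
        rw [← heq, ← hprod]
        refine expect_mono _ fun x _ => ?_
        by_cases hx : ∃ s : Fin R, (s : ℕ) < j ∧ x s ∈ S
        · rw [Set.indicator_of_notMem (by exact fun h => h hx)]
          exact zero_le
        · refine (Set.indicator_le_self' (fun _ _ => zero_le) x).trans ?_
          rw [Finset.prod_eq_one]
          · exact le_rfl
          · intro s _
            by_cases hs : (s : ℕ) < j
            · have : x s ∉ S := fun hxs => hx ⟨s, hs, hxs⟩
              simp [hs, this]
            · simp [hs]
    _ = ENNReal.ofReal ((1 - P) ^ j) := (ENNReal.ofReal_pow (by linarith) _).symm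
    _ ≤ ENNReal.ofReal (1 / 16) := by
        refine ENNReal.ofReal_le_ofReal ?_
        calc (1 - P) ^ j ≤ Real.exp (-P) ^ j := by
              have := Real.one_sub_le_exp_neg P
              gcongr
          _ = Real.exp (-(j * P)) := by rw [← Real.exp_nat_mul]; congr 1; ring
          _ ≤ Real.exp (-4) := Real.exp_le_exp.2 (by linarith)
          _ ≤ 1 / 16 := by
              rw [Real.exp_neg, one_div]
              refine inv_anti₀ (by norm_num) ?_
              have h2 : (2 : ℝ) ≤ Real.exp 1 := Real.exp_one_gt_two.le
              calc (16 : ℝ) = 2 ^ 4 := by norm_num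
                _ ≤ Real.exp 1 ^ 4 := by gcongr
                _ = Real.exp 4 := by rw [← Real.exp_nat_mul]; norm_num
    _ = 1 / 16 := by
        rw [ENNReal.ofReal_div_of_pos (by norm_num)]
        simp

end PMF

/-! ### Cells of tuples, and random colourful queries for them -/

namespace Hypergraph

variable {V : Type} [Fintype V] {d : ℕ}

/-- The number of a vertex in a fixed enumeration of the vertices. -/
noncomputable def code (v : V) : ℕ := Fintype.equivFin V v

lemma code_lt (v : V) : code v < Fintype.card V := (Fintype.equivFin V v).2

lemma code_injective : Function.Injective (code : V → ℕ) := fun _ _ h =>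
  (Fintype.equivFin V).injective (Fin.ext h)

open Classical in
/-- The injective enumerations `t` of hyperedges whose vertices have the numbers
`code (t j) ∈ [2 ^ r * f j, 2 ^ r * (f j + 1))`. Every hyperedge is enumerated `d !` times. The
cells with `r = 0` have at most one element, and every other cell splits into the `2 ^ d` cells one
level below, whose intervals are the halves of its own. -/
noncomputable def cell (H : Hypergraph V) (r : ℕ) (f : Fin d → ℕ) : Finset (Fin d → V) :=
  Finset.univ.filter fun t =>
    Function.Injective t ∧ Set.range t ∈ H.edgeSet ∧ ∀ j, code (t j) / 2 ^ r = f j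

lemma mem_cell {H : Hypergraph V} {r : ℕ} {f : Fin d → ℕ} {t : Fin d → V} :
    t ∈ H.cell r f ↔
      Function.Injective t ∧ Set.range t ∈ H.edgeSet ∧ ∀ j, code (t j) / 2 ^ r = f j := by
  simp [cell]

/-- The random bits behind one random query: a colour for every vertex, and for every coordinate a
label for every vertex. -/
abbrev Seed (V : Type) (d L : ℕ) : Type := (V → Fin d) × (Fin d → V → Fin (2 ^ L))

/-- Uniformly random colours and labels. -/
noncomputable def seedLaw (V : Type) [Fintype V] (d L : ℕ) [NeZero d] : PMF (Seed V d L) :=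
  (PMF.labelling (PMF.uniformOfFintype (Fin d))).bind fun χ =>
    (PMF.indep fun _ : Fin d => PMF.labelling (PMF.uniformOfFintype (Fin (2 ^ L)))).map fun h =>
      (χ, h)

/-- The query for the cell `(r, f)`, thinned to the density `2 ^ (-q j)` in coordinate `j`. The
colours make its sets disjoint. -/
def box {L : ℕ} (r : ℕ) (f q : Fin d → ℕ) (ω : Seed V d L) : Fin d → Set V :=
  fun j => {v | code v / 2 ^ r = f j ∧ ω.1 v = j ∧ (ω.2 j v : ℕ) < 2 ^ (L - q j)}

lemma box_disjoint {L : ℕ} (r : ℕ) (f q : Fin d → ℕ) (ω : Seed V d L) (i j : Fin d) (h : i ≠ j) :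
    Disjoint (box r f q ω i) (box r f q ω j) :=
  Set.disjoint_left.2 fun _ hi hj => h (hi.2.1.symm.trans hj.2.1)

/-- The random query for a cell is answered by Yes iff a member of the cell is coloured correctly
and survives the thinning. -/
lemma cid_box {H : Hypergraph V} (hH : H.IsUniform d) {L : ℕ} (r : ℕ) (f q : Fin d → ℕ)
    (ω : Seed V d L) :
    H.cid (box r f q ω) = true ↔ ∃ t ∈ H.cell r f, (∀ j, ω.1 (t j) = j) ∧
      ∀ j, (ω.2 j (t j) : ℕ) < 2 ^ (L - q j) := by
  rw [cid, decide_eq_true_iff, numColorful, ← Nat.pos_iff_ne_zero, Set.ncard_pos (Set.toFinite _)]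
  constructor
  · rintro ⟨e, he, hA⟩
    have : ∀ i, ∃ v, v ∈ e ∩ box r f q ω i := fun i =>
      Set.nonempty_of_ncard_ne_zero (by rw [hA i]; norm_num)
    choose t ht using this
    have hinj : Function.Injective t := fun i j hij =>
      (ht i).2.2.1.symm.trans ((congrArg ω.1 hij).trans (ht j).2.2.1)
    have hrange : Set.range t = e := by
      refine Set.eq_of_subset_of_ncard_le (Set.range_subset_iff.2 fun i => (ht i).1) ?_
        (Set.toFinite _)
      rw [hH e he, Set.ncard_range_of_injective hinj, Nat.card_eq_fintype_card, Fintype.card_fin]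
    exact ⟨t, mem_cell.2 ⟨hinj, hrange ▸ he, fun j => (ht j).2.1⟩, fun j => (ht j).2.2.1,
      fun j => (ht j).2.2.2⟩
  · rintro ⟨t, ht, hχ, hh⟩
    obtain ⟨-, he, hf⟩ := mem_cell.1 ht
    refine ⟨_, he, fun i => Set.ncard_eq_one.2 ⟨t i, ?_⟩⟩
    ext v
    constructor
    · rintro ⟨⟨j, rfl⟩, hv⟩
      rw [← hv.2.1, hχ j]
      rfl
    · rintro rfl
      exact ⟨⟨i, rfl⟩, hf i, hχ i, hh i⟩

/-- The probability that the random query for a cell is answered by Yes. -/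
noncomputable def yesProb (H : Hypergraph V) (L : ℕ) [NeZero d] (r : ℕ) (f q : Fin d → ℕ) :
    ℝ≥0∞ :=
  (seedLaw V d L).toOuterMeasure {ω | H.cid (box r f q ω) = true}

open PMF in
lemma yesProb_eq [NeZero d] {H : Hypergraph V} (hH : H.IsUniform d) (L r : ℕ)
    (f q : Fin d → ℕ) :
    H.yesProb L r f q = (labelling (uniformOfFintype (Fin d))).expect fun χ =>
      (indep fun _ : Fin d => labelling (uniformOfFintype (Fin (2 ^ L)))).toOuterMeasure
        {h | ∃ t ∈ H.cell r f, (∀ j, χ (t j) = j) ∧ ∀ j, (h j (t j) : ℕ) < 2 ^ (L - q j)} := by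
  rw [yesProb, toOuterMeasure_eq_expect, seedLaw, expect_bind]
  simp only [expect_map, toOuterMeasure_eq_expect]
  congr 1
  funext χ
  congr 1
  funext h
  simp only [Set.indicator_apply, Set.mem_ofPred_eq, cid_box hH, Pi.one_apply]

open PMF in
lemma pow_mul_yesProb_le [NeZero d] {H : Hypergraph V} (hH : H.IsUniform d) {L : ℕ} (r : ℕ)
    (f q : Fin d → ℕ) (hq : ∀ j, q j ≤ L) :
    2 ^ (∑ j, q j) * H.yesProb L r f q ≤ (H.cell r f).card := by
  classical
  rw [yesProb_eq hH, ← expect_const_mul, ← expect_const (labelling (V := V) (uniformOfFintype (Fin d)))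
    ((H.cell r f).card : ℝ≥0∞)]
  refine expect_mono _ fun χ _ => ?_
  have hpow : (2 : ℝ≥0∞) ^ (∑ j, q j) * ∏ j, (2 ^ q j)⁻¹ = 1 := by
    rw [← Finset.prod_pow_eq_pow_sum, ← Finset.prod_mul_distrib]
    exact Finset.prod_eq_one fun j _ =>
      ENNReal.mul_inv_cancel (by positivity) (ENNReal.pow_ne_top (by norm_num))
  set p := labelling (V := V) (uniformOfFintype (Fin (2 ^ L)))
  have hone : ∀ t : Fin d → V,
      (indep fun _ : Fin d => p).expect (fun h => ∏ j,
        {g : V → Fin (2 ^ L) | (g (t j) : ℕ) < 2 ^ (L - q j)}.indicator 1 (h j)) =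
      ∏ j, ((2 : ℝ≥0∞) ^ q j)⁻¹ := by
    intro t
    rw [expect_indep_prod (fun _ : Fin d => p)
      (fun j => {g : V → Fin (2 ^ L) | (g (t j) : ℕ) < 2 ^ (L - q j)}.indicator 1)]
    refine Finset.prod_congr rfl fun j _ => ?_
    rw [← toOuterMeasure_uniform_lt (hq j), toOuterMeasure_eq_expect]
    exact (expect_map _ _ _).trans (expect_indep_apply
      (fun _ : Fin (Fintype.card V) => uniformOfFintype (Fin (2 ^ L))) (Fintype.equivFin V (t j))
      ({x : Fin (2 ^ L) | (x : ℕ) < 2 ^ (L - q j)}.indicator 1))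
  calc _ ≤ (2 : ℝ≥0∞) ^ (∑ j, q j) * (indep fun _ : Fin d => p).expect (fun h =>
        ∑ t ∈ H.cell r f, ∏ j,
          {g : V → Fin (2 ^ L) | (g (t j) : ℕ) < 2 ^ (L - q j)}.indicator 1 (h j)) := by
        gcongr
        rw [toOuterMeasure_eq_expect]
        refine expect_mono _ fun h _ => ?_
        by_cases hh : ∃ t ∈ H.cell r f, (∀ j, χ (t j) = j) ∧
            ∀ j, (h j (t j) : ℕ) < 2 ^ (L - q j)
        · refine (Set.indicator_le_self' (fun _ _ => zero_le) h).trans ?_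
          obtain ⟨t, ht, -, hth⟩ := hh
          refine le_trans ?_ (Finset.single_le_sum (fun _ _ => zero_le) ht)
          rw [Finset.prod_eq_one]
          · exact le_rfl
          · intro j _
            simp [hth j]
        · rw [Set.indicator_of_notMem (by exact hh)]
          exact zero_le
    _ = (H.cell r f).card := by
        rw [expect_finsetSum]
        simp only [hone, Finset.sum_const, nsmul_eq_mul]
        rw [mul_left_comm, hpow, mul_one]

open PMF in
/-- An injective tuple is coloured correctly with probability at least `1 / d ^ d`. -/
lemma one_le_pow_mul_colour [NeZero d] {t : Fin d → V} (ht : Function.Injective t) :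
    1 ≤ (d : ℝ≥0∞) ^ d * (labelling (uniformOfFintype (Fin d))).toOuterMeasure
      {χ : V → Fin d | ∀ j, χ (t j) = j} := by
  classical
  have hd : (d : ℝ≥0∞) ≠ 0 := by exact_mod_cast NeZero.ne d
  set p := uniformOfFintype (Fin d)
  set A : Finset V := Finset.univ.image t
  have hprod := expect_labelling_prod p
    (fun v => if v ∈ A then {x | t x = v}.indicator 1 else fun _ => 1)
  have heq : ∏ v, p.expect (if v ∈ A then {x | t x = v}.indicator 1 else fun _ => 1) =
      ((d : ℝ≥0∞)⁻¹) ^ d := by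
    rw [← Finset.prod_subset (Finset.subset_univ A) (by
      intro v _ hv
      simp [hv, expect_const])]
    rw [Finset.prod_congr rfl (g := fun _ => (d : ℝ≥0∞)⁻¹), Finset.prod_const,
      Finset.card_image_of_injective _ ht, Finset.card_univ, Fintype.card_fin]
    intro v hv
    obtain ⟨i, -, rfl⟩ := Finset.mem_image.1 hv
    rw [if_pos hv, expect_fintype, Finset.sum_eq_single i]
    · simp [p]
    · intro b _ hb
      have : t b ≠ t i := fun h => hb (ht h)
      simp [this]
    · simp
  calc (1 : ℝ≥0∞) = (d : ℝ≥0∞) ^ d * ((d : ℝ≥0∞)⁻¹) ^ d := by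
        rw [← mul_pow, ENNReal.mul_inv_cancel hd (ENNReal.natCast_ne_top d), one_pow]
    _ ≤ _ := by
        gcongr
        rw [← heq, ← hprod, toOuterMeasure_eq_expect]
        refine expect_mono _ fun χ _ => ?_
        by_cases hχ : ∀ j, χ (t j) = j
        · rw [Set.indicator_of_mem (by exact hχ)]
          refine Finset.prod_le_one' fun v _ => ?_
          split_ifs
          · exact Set.indicator_le_self' (fun _ _ => zero_le) _
          · exact le_rfl
        · obtain ⟨j, hj⟩ := not_forall.1 hχ
          rw [Finset.prod_eq_zero (Finset.mem_univ (t j))]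
          · exact zero_le
          · have hA : t j ∈ A := Finset.mem_image_of_mem _ (Finset.mem_univ j)
            have : t (χ (t j)) ≠ t j := fun h => hj (ht h)
            simp [hA, this]

open PMF in
/-- Some density `q` detects a nonempty cell `F` with a probability that is both not too small and,
after scaling with `2 ^ ∑ q`, close to `|F|`. -/
lemma exists_density [NeZero d] {H : Hypergraph V} (hH : H.IsUniform d) {L : ℕ}
    (hL : Fintype.card V ≤ 2 ^ L) (r : ℕ) (f : Fin d → ℕ) (hne : (H.cell r f).card ≠ 0) :
    ∃ q : Fin d → Fin (L + 1), 2 ^ (∑ j, (q j : ℕ)) ≤ (H.cell r f).card ∧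
      ((H.cell r f).card : ℝ≥0∞) ≤ ((4 * d * (L + 1)) ^ d : ℕ) *
        (2 ^ (∑ j, (q j : ℕ)) * H.yesProb L r f fun j => q j) := by
  classical
  set M := (H.cell r f).card with hM
  set pχ := labelling (V := V) (uniformOfFintype (Fin d))
  set p := labelling (V := V) (uniformOfFintype (Fin (2 ^ L)))
  set Fχ : (V → Fin d) → Finset (Fin d → V) := fun χ =>
    (H.cell r f).filter fun t => ∀ j, χ (t j) = j with hFχ
  set g : (Fin d → Fin (L + 1)) → ℝ≥0∞ := fun q =>
    if 2 ^ (∑ j, (q j : ℕ)) ≤ M then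
      2 ^ (∑ j, (q j : ℕ)) * H.yesProb L r f fun j => q j else 0 with hg
  have hlog : ∀ G : Finset V, Nat.log 2 G.card ≤ L := by
    intro G
    calc Nat.log 2 G.card ≤ Nat.log 2 (2 ^ L) :=
          Nat.log_mono_right ((Finset.card_le_univ G).trans hL)
      _ = L := Nat.log_pow (by norm_num) L
  have hcolour : (M : ℝ≥0∞) ≤ (d : ℝ≥0∞) ^ d * pχ.expect fun χ => ((Fχ χ).card : ℝ≥0∞) := by
    have hsum : (pχ.expect fun χ => ((Fχ χ).card : ℝ≥0∞)) =
        ∑ t ∈ H.cell r f, pχ.toOuterMeasure {χ | ∀ j, χ (t j) = j} := by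
      simp only [toOuterMeasure_eq_expect]
      rw [← expect_finsetSum]
      congr 1
      funext χ
      rw [hFχ, Finset.card_filter]
      push_cast
      refine Finset.sum_congr rfl fun t _ => ?_
      simp [Set.indicator_apply]
    rw [hsum, Finset.mul_sum, hM, Finset.card_eq_sum_ones]
    push_cast
    exact Finset.sum_le_sum fun t ht => one_le_pow_mul_colour (mem_cell.1 ht).1
  have hsum : (M : ℝ≥0∞) ≤ (d : ℝ≥0∞) ^ d * (4 ^ d * ∑ q, g q) := by
    refine hcolour.trans ?_
    gcongr
    calc (pχ.expect fun χ => ((Fχ χ).card : ℝ≥0∞))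
        ≤ pχ.expect fun χ => 4 ^ d * ∑ q : Fin d → Fin (L + 1),
            if 2 ^ (∑ j, (q j : ℕ)) ≤ M then 2 ^ (∑ j, (q j : ℕ)) *
              (indep fun _ : Fin d => p).toOuterMeasure
                {h | ∃ t ∈ Fχ χ, ∀ j, (h j (t j) : ℕ) < 2 ^ (L - q j)} else 0 := by
          refine expect_mono _ fun χ _ => card_le_sum_hit p
            (fun h q v => (h v : ℕ) < 2 ^ (L - q)) L hlog
            (fun G hG => card_le_hit G hG (hlog G)) (Fχ χ) ?_
          exact Finset.card_filter_le _ _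
      _ = 4 ^ d * ∑ q, g q := by
          rw [expect_const_mul, expect_finsetSum]
          congr 1
          refine Finset.sum_congr rfl fun q _ => ?_
          by_cases hq : 2 ^ (∑ j, (q j : ℕ)) ≤ M
          · simp only [hg, if_pos hq]
            rw [expect_const_mul, yesProb_eq hH]
            simp only [hFχ, Finset.mem_filter, and_assoc]
            rfl
          · simp only [hg, if_neg hq, expect_const]
  obtain ⟨q, -, hq⟩ := Finset.exists_max_image Finset.univ g Finset.univ_nonempty
  have hfin : (M : ℝ≥0∞) ≤ ((4 * d * (L + 1)) ^ d : ℕ) * g q := by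
    calc (M : ℝ≥0∞) ≤ (d : ℝ≥0∞) ^ d * (4 ^ d * ∑ q, g q) := hsum
      _ ≤ (d : ℝ≥0∞) ^ d * (4 ^ d * ∑ _q : Fin d → Fin (L + 1), g q) := by
          gcongr with q' _
          exact hq q' (Finset.mem_univ _)
      _ = _ := by
          simp only [Finset.sum_const, Finset.card_univ, Fintype.card_pi, Fintype.card_fin,
            Finset.prod_const, nsmul_eq_mul]
          push_cast
          rw [mul_pow, mul_pow]
          ring
  refine ⟨q, ?_, ?_⟩
  · by_contra hle
    simp only [hg, if_neg hle, mul_zero, nonpos_iff_eq_zero, Nat.cast_eq_zero] at hfin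
    exact hne hfin
  · refine hfin.trans ?_
    gcongr
    simp only [hg]
    split_ifs
    · exact le_rfl
    · exact zero_le

end Hypergraph

/-! ### The coarse estimator -/

namespace CIDAlgorithm

open Hypergraph PMF

variable {V : Type} {d L T R : ℕ}

open Classical in
/-- More than half of `T` groups of `R` answers contain a Yes among their first `j` answers. -/
def Passes (ans : Fin T → Fin R → Bool) (j : ℕ) : Prop :=
  T < 2 * (Finset.univ.filter fun t => ∃ s : Fin R, (s : ℕ) < j ∧ ans t s = true).card

open Classical in
/-- The coarse estimate obtained from the answers at all densities `q`: passing the test with `j`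
queries per group suggests that a random query at density `q` is answered by Yes with probability at
least about `1 / j`, and thus that there are at least about `2 ^ (∑ q) / j` tuples. -/
noncomputable def coarseValue (ans : (Fin d → Fin (L + 1)) → Fin T → Fin R → Bool) : ℝ≥0 :=
  (Finset.univ : Finset ((Fin d → Fin (L + 1)) × Fin (R + 1))).sup fun i =>
    if Passes (ans i.1) i.2 then 2 ^ (∑ j, (i.1 j : ℕ)) / (16 * (i.2 : ℕ)) else 0

variable [Fintype V]

/-- The coarse estimate of the size of a cell. -/
noncomputable def coarse (H : Hypergraph V) (ω : Fin T → Fin R → Seed V d L) (r : ℕ)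
    (f : Fin d → ℕ) : ℝ≥0 :=
  coarseValue fun (q : Fin d → Fin (L + 1)) t s => H.cid (box r f (fun j => q j) (ω t s))

/-- The algorithm that computes the coarse estimate of the size of a cell. -/
noncomputable def coarseAlg (ω : Fin T → Fin R → Seed V d L) (r : ℕ) (f : Fin d → ℕ) :
    CIDAlgorithm V d ℝ≥0 :=
  (family fun i : (Fin d → Fin (L + 1)) × Fin T × Fin R =>
    ask (box r f (fun j => i.1 j) (ω i.2.1 i.2.2)) (box_disjoint _ _ _ _)).bind fun ans =>
      output (coarseValue fun q t s => ans (q, t, s))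

lemma law_coarseAlg (H : Hypergraph V) (ω : Fin T → Fin R → Seed V d L) (r : ℕ)
    (f : Fin d → ℕ) : (coarseAlg ω r f).law H = PMF.pure (coarse H ω r f) := by
  rw [coarseAlg, law_bind, law_family_pure H fun i => law_ask H _ _, PMF.pure_bind]
  rfl

lemma queriesAtMost_coarseAlg (ω : Fin T → Fin R → Seed V d L) (r : ℕ) (f : Fin d → ℕ) :
    (coarseAlg ω r f).QueriesAtMost ((L + 1) ^ d * (T * R)) := by
  have h := (QueriesAtMost.family fun i : (Fin d → Fin (L + 1)) × Fin T × Fin R =>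
    queriesAtMost_ask (box r f (fun j => i.1 j) (ω i.2.1 i.2.2)) (box_disjoint _ _ _ _)).bind
      (f := fun ans => output (coarseValue fun q t s => ans (q, t, s))) (N' := 0) fun _ => trivial
  simpa [coarseAlg] using h

/-- The seeds make every coarse estimate correct, up to a factor `80 * Q`. -/
def GoodSeeds (H : Hypergraph V) (Q : ℕ) (ω : Fin T → Fin R → Seed V d L) : Prop :=
  ∀ r ≤ L, ∀ f : Fin d → ℕ, coarse H ω r f ≤ (H.cell r f).card ∧
    ((H.cell r f).card : ℝ≥0) ≤ 80 * Q * coarse H ω r f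

variable [NeZero d]

/-- The tests of a cell all give the answer that is to be expected from the probability of Yes. -/
def GoodTests (H : Hypergraph V) (r : ℕ) (f : Fin d → ℕ) (ω : Fin T → Fin R → Seed V d L) :
    Prop :=
  ∀ (q : Fin d → Fin (L + 1)) (j : Fin (R + 1)),
    ((j : ℕ) * H.yesProb L r f (fun i => q i) ≤ 1 / 16 →
      ¬ Passes (fun t s => H.cid (box r f (fun i => q i) (ω t s))) j) ∧
    (4 ≤ (j : ℕ) * H.yesProb L r f (fun i => q i) →
      Passes (fun t s => H.cid (box r f (fun i => q i) (ω t s))) j)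

lemma coarse_le_of_goodTests {H : Hypergraph V} (hH : H.IsUniform d) {r : ℕ} {f : Fin d → ℕ}
    {ω : Fin T → Fin R → Seed V d L} (h : GoodTests H r f ω) :
    coarse H ω r f ≤ (H.cell r f).card := by
  refine Finset.sup_le fun i _ => ?_
  split_ifs with hi
  · have hnot : ¬ ((i.2 : ℕ) * H.yesProb L r f (fun j => i.1 j) ≤ 1 / 16) :=
      fun hle => (h i.1 i.2).1 hle hi
    have hub := pow_mul_yesProb_le hH (L := L) r f (fun j => i.1 j)
      fun j => Nat.lt_succ_iff.1 (i.1 j).2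
    rcases Nat.eq_zero_or_pos (i.2 : ℕ) with h0 | hpos
    · simp [h0]
    · rw [div_le_iff₀ (by positivity)]
      have h1 : (1 : ℝ≥0∞) ≤ 16 * ((i.2 : ℕ) * H.yesProb L r f (fun j => i.1 j)) := by
        calc (1 : ℝ≥0∞) = 16 * (1 / 16) := by
              rw [ENNReal.mul_div_cancel (by norm_num) (by norm_num)]
          _ ≤ _ := by
              gcongr
              exact (not_le.1 hnot).le
      have h2 : (2 : ℝ≥0∞) ^ (∑ j, (i.1 j : ℕ)) ≤ (H.cell r f).card * (16 * (i.2 : ℕ)) := by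
        calc (2 : ℝ≥0∞) ^ (∑ j, (i.1 j : ℕ)) = 2 ^ (∑ j, (i.1 j : ℕ)) * 1 := (mul_one _).symm
          _ ≤ 2 ^ (∑ j, (i.1 j : ℕ)) *
              (16 * ((i.2 : ℕ) * H.yesProb L r f (fun j => i.1 j))) := by gcongr
          _ = (2 ^ (∑ j, (i.1 j : ℕ)) * H.yesProb L r f (fun j => i.1 j)) *
              (16 * (i.2 : ℕ)) := by ring
          _ ≤ _ := by gcongr
      exact_mod_cast h2
  · exact zero_le

lemma card_le_of_goodTests {H : Hypergraph V} (hH : H.IsUniform d) {r : ℕ} {f : Fin d → ℕ}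
    {ω : Fin T → Fin R → Seed V d L} (h : GoodTests H r f ω) (hL : Fintype.card V ≤ 2 ^ L)
    (hR : 5 * (4 * d * (L + 1)) ^ d ≤ R) :
    ((H.cell r f).card : ℝ≥0) ≤ 80 * ((4 * d * (L + 1)) ^ d : ℕ) * coarse H ω r f := by
  set Q := (4 * d * (L + 1)) ^ d with hQ
  have hQ1 : 1 ≤ Q := Nat.one_le_pow _ _ (by have := NeZero.pos d; positivity)
  rcases eq_or_ne (H.cell r f).card 0 with h0 | hne
  · rw [h0]
    simp
  obtain ⟨q, hq1, hq2⟩ := exists_density hH hL r f hne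
  set M := (H.cell r f).card with hM
  set S := ∑ j, (q j : ℕ) with hS
  set P := H.yesProb L r f (fun j => q j) with hP
  have hPtop : P ≠ ⊤ := ne_top_of_le_ne_top ENNReal.one_ne_top (toOuterMeasure_le_one _ _)
  set p : ℝ≥0 := P.toNNReal with hp
  have hPp : P = p := (ENNReal.coe_toNNReal hPtop).symm
  have hp1 : p ≤ 1 := by
    have : P ≤ 1 := toOuterMeasure_le_one _ _
    rw [hPp] at this
    exact_mod_cast this
  have hMle : (M : ℝ≥0) ≤ Q * (2 ^ S * p) := by
    rw [hPp] at hq2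
    exact_mod_cast hq2
  have hQp : 1 ≤ Q * p := by
    have h1 : (2 : ℝ≥0) ^ S * 1 ≤ 2 ^ S * (Q * p) := by
      calc (2 : ℝ≥0) ^ S * 1 ≤ M := by rw [mul_one]; exact_mod_cast hq1
        _ ≤ _ := hMle
        _ = _ := by ring
    exact le_of_mul_le_mul_left h1 (by positivity)
  have hp0 : 0 < p := by
    rcases eq_or_ne p 0 with h0 | h0
    · simp [h0] at hQp
    · exact pos_iff_ne_zero.2 h0
  -- `j` is about `4 / p`: large enough for the test to pass, small enough for a good estimate.
  set j := ⌈4 / p⌉₊ with hj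
  have hj4 : 4 ≤ (j : ℝ≥0) * p := by
    have := Nat.le_ceil (4 / p)
    rwa [div_le_iff₀ hp0] at this
  have hj5 : (j : ℝ≥0) * p ≤ 5 := by
    have h1 : (j : ℝ≥0) ≤ 4 / p + 1 := (Nat.ceil_lt_add_one zero_le).le
    calc (j : ℝ≥0) * p ≤ (4 / p + 1) * p := by gcongr
      _ = 4 + p := by rw [add_mul, div_mul_cancel₀ _ hp0.ne', one_mul]
      _ ≤ 4 + 1 := by gcongr
      _ = 5 := by norm_num
  have hjR : j ≤ R := by
    have h1 : (j : ℝ≥0) ≤ (5 * Q : ℕ) := by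
      calc (j : ℝ≥0) = j * 1 := (mul_one _).symm
        _ ≤ j * (Q * p) := by gcongr
        _ = Q * (j * p) := by ring
        _ ≤ Q * 5 := by gcongr
        _ = (5 * Q : ℕ) := by push_cast; ring
    exact (Nat.cast_le.1 h1).trans hR
  have hpass := (h q ⟨j, Nat.lt_succ_of_le hjR⟩).2 (by
    rw [← hP, hPp]
    exact_mod_cast hj4)
  have hsup : (2 : ℝ≥0) ^ S / (16 * j) ≤ coarse H ω r f := by
    classical
    refine le_trans (le_of_eq ?_) (Finset.le_sup
      (f := fun i : (Fin d → Fin (L + 1)) × Fin (R + 1) =>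
        if Passes (fun t s => H.cid (box r f (fun l => i.1 l) (ω t s))) i.2 then
          (2 : ℝ≥0) ^ (∑ l, (i.1 l : ℕ)) / (16 * (i.2 : ℕ)) else 0)
      (Finset.mem_univ (q, ⟨j, Nat.lt_succ_of_le hjR⟩)))
    simp only
    rw [if_pos hpass]
  have hjpos : 0 < (j : ℝ≥0) := by
    rcases eq_or_ne (j : ℝ≥0) 0 with h0 | h0
    · simp [h0] at hj4
    · exact pos_iff_ne_zero.2 h0
  calc (M : ℝ≥0) ≤ Q * (2 ^ S * p) := hMle
    _ = 16 * Q * (2 ^ S / (16 * j)) * (j * p) := by field_simp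
    _ ≤ 16 * Q * coarse H ω r f * 5 := by gcongr
    _ = _ := by ring

lemma toOuterMeasure_not_goodTests_le (H : Hypergraph V) (r : ℕ) (f : Fin d → ℕ) :
    (indep fun _ : Fin T => indep fun _ : Fin R => seedLaw V d L).toOuterMeasure
      {ω | ¬ GoodTests H r f ω} ≤ ((L + 1) ^ d * (R + 1) : ℕ) * (1 / 2) ^ T := by
  classical
  set p := indep fun _ : Fin R => seedLaw V d L with hp
  -- One unlikely event for every test; the two premises exclude each other.
  set yes : (Fin d → Fin (L + 1)) × Fin (R + 1) → Set (Fin R → Seed V d L) := fun i =>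
    {x | ∃ s : Fin R, (s : ℕ) < i.2 ∧ x s ∈ {ω | H.cid (box r f (fun l => i.1 l) ω) = true}}
    with hyes
  set bad : (Fin d → Fin (L + 1)) × Fin (R + 1) → Set (Fin R → Seed V d L) := fun i =>
    if (i.2 : ℕ) * H.yesProb L r f (fun l => i.1 l) ≤ 1 / 16 then yes i else
      if 4 ≤ (i.2 : ℕ) * H.yesProb L r f (fun l => i.1 l) then (yes i)ᶜ else ∅ with hbad
  have hsmall : ∀ i, p.toOuterMeasure (bad i) ≤ 1 / 16 := by
    intro i
    simp only [hbad]
    split_ifs with h1 h2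
    · exact (toOuterMeasure_iid_exists_lt_le _ _ _).trans h1
    · exact toOuterMeasure_iid_not_exists_lt_le _ _ (Nat.lt_succ_iff.1 i.2.2) h2
    · simp
  have hsub : {ω : Fin T → Fin R → Seed V d L | ¬ GoodTests H r f ω} ⊆
      ⋃ i ∈ (Finset.univ : Finset ((Fin d → Fin (L + 1)) × Fin (R + 1))),
        {ω | T ≤ 2 * (Finset.univ.filter fun t => ω t ∈ bad i).card} := by
    intro ω hω
    by_contra hcon
    simp only [Finset.mem_univ, Set.iUnion_true, Set.mem_iUnion, Set.mem_ofPred_eq, not_exists,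
      not_le] at hcon
    refine hω fun q j => ⟨fun h1 hpass => ?_, fun h4 => ?_⟩
    · have := hcon (q, j)
      have hb : bad (q, j) = yes (q, j) := if_pos h1
      rw [hb] at this
      rw [Passes] at hpass
      refine absurd this (not_lt.2 (le_of_lt (lt_of_lt_of_eq hpass ?_)))
      congr 2
      ext t
      simp only [Finset.mem_filter]
      exact Iff.rfl
    · have := hcon (q, j)
      have hn : ¬ ((j : ℕ) * H.yesProb L r f (fun l => q l) ≤ 1 / 16) := by
        intro h1
        have h41 : (4 : ℝ≥0∞) ≤ 1 := (h4.trans h1).trans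
          (ENNReal.div_le_of_le_mul (by norm_num))
        exact absurd h41 (by norm_num)
      have hb : bad (q, j) = (yes (q, j))ᶜ := (if_neg hn).trans (if_pos h4)
      rw [hb] at this
      have hc := Finset.card_filter_add_card_filter_not (s := (Finset.univ : Finset (Fin T)))
        (fun t => ω t ∈ yes (q, j))
      rw [Finset.card_univ, Fintype.card_fin] at hc
      simp only [Set.mem_compl_iff] at this
      have : T < 2 * (Finset.univ.filter fun t => ω t ∈ yes (q, j)).card := by omega
      exact this
  refine ((MeasureTheory.measure_mono hsub).trans
    (MeasureTheory.measure_biUnion_finset_le _ _)).trans ?_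
  calc _ ≤ ∑ _i : (Fin d → Fin (L + 1)) × Fin (R + 1), (1 / 2 : ℝ≥0∞) ^ T :=
        Finset.sum_le_sum fun i _ => toOuterMeasure_iid_majority_le p (hsmall i)
    _ = _ := by
        simp [Finset.sum_const, Fintype.card_prod]

/-- The union bound over all nonempty cells and all tests. -/
lemma toOuterMeasure_not_goodSeeds_le {H : Hypergraph V} (hH : H.IsUniform d)
    (hL : Fintype.card V ≤ 2 ^ L) (hR : 5 * (4 * d * (L + 1)) ^ d ≤ R) :
    (indep fun _ : Fin T => indep fun _ : Fin R => seedLaw V d L).toOuterMeasure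
      {ω | ¬ GoodSeeds H ((4 * d * (L + 1)) ^ d) ω} ≤
      ((L + 1) * Fintype.card V ^ d * ((L + 1) ^ d * (R + 1)) : ℕ) * (1 / 2) ^ T := by
  classical
  have hsub : {ω : Fin T → Fin R → Seed V d L | ¬ GoodSeeds H ((4 * d * (L + 1)) ^ d) ω} ⊆
      ⋃ i ∈ (Finset.univ : Finset (Fin (L + 1) × (Fin d → V))),
        {ω | ¬ GoodTests H i.1 (fun j => code (i.2 j) / 2 ^ (i.1 : ℕ)) ω} := by
    intro ω hω
    by_contra hcon
    simp only [Finset.mem_univ, Set.iUnion_true, Set.mem_iUnion, Set.mem_ofPred_eq, not_exists,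
      not_not] at hcon
    refine hω fun r hr f => ?_
    rcases (H.cell r f).eq_empty_or_nonempty with h0 | ⟨t, ht⟩
    · -- All queries for an empty cell are answered by No.
      have hc : coarse H ω r f = 0 := by
        refine le_antisymm (Finset.sup_le fun i _ => ?_) zero_le
        rw [if_neg]
        have hno : ∀ t s, ¬ H.cid (box r f (fun j => i.1 j) (ω t s)) = true := by
          intro t s
          rw [cid_box hH, h0]
          simp
        simp [Passes, hno]
      simp [hc, h0]
    · have hf : f = fun j => code (t j) / 2 ^ r := funext fun j => ((mem_cell.1 ht).2.2 j).symm
      have hg := hcon (⟨r, Nat.lt_succ_of_le hr⟩, t)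
      simp only [← hf] at hg
      exact ⟨coarse_le_of_goodTests hH hg, card_le_of_goodTests hH hg hL hR⟩
  refine ((MeasureTheory.measure_mono hsub).trans
    (MeasureTheory.measure_biUnion_finset_le _ _)).trans ?_
  calc _ ≤ ∑ _i : Fin (L + 1) × (Fin d → V),
        ((L + 1) ^ d * (R + 1) : ℕ) * (1 / 2 : ℝ≥0∞) ^ T :=
        Finset.sum_le_sum fun i _ => toOuterMeasure_not_goodTests_le H _ _
    _ = _ := by
        simp only [Finset.sum_const, Finset.card_univ, Fintype.card_prod, Fintype.card_pi,
          Fintype.card_fin, Finset.prod_const, nsmul_eq_mul]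
        push_cast
        ring

end CIDAlgorithm

/-! ### The particle filter -/

namespace PMF

variable {ι : Type} [Fintype ι]

/-- A random index, with probabilities proportional to given weights. -/
noncomputable def weighted (w : ι → ℝ≥0) (h : ∑ i, w i ≠ 0) : PMF ι :=
  PMF.ofFintype (fun i => ((w i / ∑ j, w j : ℝ≥0) : ℝ≥0∞)) (by
    rw [← ENNReal.ofNNReal_finsetSum, ← Finset.sum_div, div_self h, ENNReal.coe_one])

lemma weighted_apply (w : ι → ℝ≥0) (h : ∑ i, w i ≠ 0) (i : ι) :
    weighted w h i = ((w i / ∑ j, w j : ℝ≥0) : ℝ≥0∞) := rfl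

lemma expect_weighted (w : ι → ℝ≥0) (h : ∑ i, w i ≠ 0) (g : ι → ℝ≥0) :
    (weighted w h).expect (fun i => (g i : ℝ≥0∞)) =
      ((∑ i, w i / (∑ j, w j) * g i : ℝ≥0) : ℝ≥0∞) := by
  rw [expect_fintype]
  simp only [weighted_apply]
  push_cast
  rfl

end PMF

namespace Hypergraph

variable {V : Type} [Fintype V] {d : ℕ}

/-- The cells one level below a cell: every coordinate goes to one half of its interval. -/
def child (f : Fin d → ℕ) (u : Fin d → Fin 2) : Fin d → ℕ := fun j => 2 * f j + u j

lemma mem_cell_child {H : Hypergraph V} {r : ℕ} {f : Fin d → ℕ} {u : Fin d → Fin 2}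
    {t : Fin d → V} :
    t ∈ H.cell r (child f u) ↔
      t ∈ H.cell (r + 1) f ∧ (fun j => Fin.ofNat 2 (code (t j) / 2 ^ r)) = u := by
  rw [mem_cell, mem_cell, funext_iff, and_assoc, and_assoc, ← forall_and]
  refine and_congr_right fun _ => and_congr_right fun _ => forall_congr' fun j => ?_
  rw [child, pow_succ, ← Nat.div_div_eq_div_mul, Fin.ext_iff, Fin.val_ofNat]
  have := (u j).2
  omega

lemma card_cell_succ (H : Hypergraph V) (r : ℕ) (f : Fin d → ℕ) :
    (H.cell (r + 1) f).card = ∑ u, (H.cell r (child f u)).card := by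
  classical
  rw [Finset.card_eq_sum_card_fiberwise (f := fun t j => Fin.ofNat 2 (code (t j) / 2 ^ r))
    (t := Finset.univ) (fun _ _ => Finset.mem_coe.2 (Finset.mem_univ _))]
  refine Finset.sum_congr rfl fun u _ => congrArg Finset.card ?_
  ext t
  rw [Finset.mem_filter, mem_cell_child]

lemma card_cell_zero_le (H : Hypergraph V) (f : Fin d → ℕ) : (H.cell 0 f).card ≤ 1 := by
  refine Finset.card_le_one.2 fun s hs t ht => funext fun j => code_injective ?_
  have hs' := (mem_cell.1 hs).2.2 j
  have ht' := (mem_cell.1 ht).2.2 j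
  simp only [pow_zero, Nat.div_one] at hs' ht'
  rw [hs', ht']

end Hypergraph

namespace CIDAlgorithm

open Hypergraph PMF

variable {V : Type} {d k : ℕ}

/-- The particle filter: an estimator for `∑ i, w i * |cell r (f i)|`, for `k` weighted cells
`s i = (f i, w i)` at level `r`. All cells below the given ones are assessed by the coarse
estimator `est`; then `k` of them are drawn independently with probabilities proportional to weight
times coarse estimate, and reweighted so that the expectation does not change. -/
noncomputable def filterAlg (est : ℕ → (Fin d → ℕ) → CIDAlgorithm V d ℝ≥0) :
    ℕ → (Fin k → (Fin d → ℕ) × ℝ≥0) → CIDAlgorithm V d ℝ≥0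
  | 0, s => (seq fun i => est 0 (s i).1).bind fun x =>
      output (∑ i, if x i = 0 then 0 else (s i).2)
  | r + 1, s =>
      (family fun i : Fin k × (Fin d → Fin 2) => est r (child (s i.1).1 i.2)).bind fun x =>
        if h : ∑ i : Fin k × (Fin d → Fin 2), (s i.1).2 * x i = 0 then output 0 else
          draw (indep fun _ : Fin k => weighted (fun i => (s i.1).2 * x i) h) fun l =>
            filterAlg est r fun a => (child (s (l a).1).1 (l a).2,
              (∑ i : Fin k × (Fin d → Fin 2), (s i.1).2 * x i) / (k * x (l a)))

lemma queriesAtMost_filterAlg {est : ℕ → (Fin d → ℕ) → CIDAlgorithm V d ℝ≥0} {N : ℕ}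
    (hest : ∀ r f, (est r f).QueriesAtMost N) (r : ℕ) (s : Fin k → (Fin d → ℕ) × ℝ≥0) :
    (filterAlg est r s).QueriesAtMost ((r + 1) * (k * 2 ^ d * N)) := by
  induction r generalizing s with
  | zero =>
    rw [filterAlg]
    refine ((QueriesAtMost.seq fun i => hest 0 (s i).1).bind (N' := 0) fun _ => ?_).mono ?_
    · trivial
    rw [add_zero, zero_add, one_mul]
    gcongr
    exact Nat.le_mul_of_pos_right k (by positivity)
  | succ r ih =>
    rw [filterAlg]
    refine ((QueriesAtMost.family fun i : Fin k × (Fin d → Fin 2) =>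
      hest r (child (s i.1).1 i.2)).bind (N' := (r + 1) * (k * 2 ^ d * N)) fun x => ?_).mono ?_
    · split_ifs
      · trivial
      · exact fun l _ => ih _
    · simp only [Fintype.card_prod, Fintype.card_pi, Fintype.card_fin, Finset.prod_const,
        Finset.card_univ]
      exact le_of_eq (by ring)

section Moments

variable [Fintype V] {H : Hypergraph V} {est : ℕ → (Fin d → ℕ) → CIDAlgorithm V d ℝ≥0}
  {c : ℕ → (Fin d → ℕ) → ℝ≥0} {b : ℝ≥0} {L : ℕ}

/-- One step of the particle filter: the mean and second moment of the contribution
`S / (k * c i) * m i` of one new particle, drawn with probability proportional to `w i * c i`. -/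
lemma resampling_moments {ι : Type} [Fintype ι] (w c m : ι → ℝ≥0) (hk : k ≠ 0)
    (hc : ∀ i, c i ≤ m i ∧ m i ≤ b * c i) (hS : ∑ i, w i * c i ≠ 0) :
    (k * ∑ i, w i * c i / (∑ j, w j * c j) * ((∑ j, w j * c j) / (k * c i) * m i) =
      ∑ i, w i * m i) ∧
    k * ∑ i, w i * c i / (∑ j, w j * c j) * ((∑ j, w j * c j) / (k * c i) * m i) ^ 2 ≤
      b / k * (∑ i, w i * m i) ^ 2 := by
  set S := ∑ j, w j * c j with hSdef
  have hk' : (k : ℝ≥0) ≠ 0 := by exact_mod_cast hk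
  constructor
  · rw [Finset.mul_sum]
    refine Finset.sum_congr rfl fun i _ => ?_
    rcases eq_or_ne (c i) 0 with h0 | h0
    · have : m i = 0 := by simpa [h0] using (hc i).2
      simp [this]
    · field_simp
  · have hSle : S ≤ ∑ i, w i * m i := by
      refine Finset.sum_le_sum fun i _ => ?_
      gcongr
      exact (hc i).1
    calc k * ∑ i, w i * c i / S * (S / (k * c i) * m i) ^ 2
        ≤ k * ∑ i, S * b / k ^ 2 * (w i * m i) := by
          refine mul_le_mul' le_rfl (Finset.sum_le_sum fun i _ => ?_)
          rcases eq_or_ne (c i) 0 with h0 | h0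
          · simp [h0]
          · have hci : 0 < c i := pos_iff_ne_zero.2 h0
            have hmi : m i / c i ≤ b := by
              rw [div_le_iff₀ hci]
              exact (hc i).2
            calc w i * c i / S * (S / (k * c i) * m i) ^ 2
                = S * (m i / c i) / k ^ 2 * (w i * m i) := by field_simp
              _ ≤ _ := by gcongr
      _ = b / k * (S * ∑ i, w i * m i) := by
          rw [← Finset.mul_sum]
          field_simp
      _ ≤ b / k * ((∑ i, w i * m i) * ∑ i, w i * m i) := by gcongr
      _ = _ := by rw [sq]

/-- The particle filter is unbiased, and every level increases its second moment at most by the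
factor `1 + b / k`. -/
lemma filterAlg_moments (hest : ∀ r f, (est r f).law H = PMF.pure (c r f)) (hk : k ≠ 0)
    (hc : ∀ r ≤ L, ∀ f, c r f ≤ (H.cell r f).card ∧ ((H.cell r f).card : ℝ≥0) ≤ b * c r f)
    {r : ℕ} (hr : r ≤ L) (s : Fin k → (Fin d → ℕ) × ℝ≥0) :
    ((filterAlg est r s).law H).expect (fun z => (z : ℝ≥0∞)) =
      ((∑ i, (s i).2 * (H.cell r (s i).1).card : ℝ≥0) : ℝ≥0∞) ∧
    ((filterAlg est r s).law H).expect (fun z => (z : ℝ≥0∞) ^ 2) ≤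
      (((1 + b / k) ^ r * (∑ i, (s i).2 * (H.cell r (s i).1).card) ^ 2 : ℝ≥0) : ℝ≥0∞) := by
  induction r generalizing s with
  | zero =>
    have hval : ∀ i, (if c 0 (s i).1 = 0 then 0 else (s i).2) =
        (s i).2 * (H.cell 0 (s i).1).card := by
      intro i
      have h1 := card_cell_zero_le H (s i).1
      obtain ⟨h2, h3⟩ := hc 0 hr (s i).1
      split_ifs with h0
      · have : ((H.cell 0 (s i).1).card : ℝ≥0) = 0 := by simpa [h0] using h3
        simp [this]
      · have hne : (H.cell 0 (s i).1).card ≠ 0 := by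
          intro hz
          rw [hz] at h2
          exact h0 (by simpa using h2)
        have : (H.cell 0 (s i).1).card = 1 := by omega
        simp [this]
    have hlaw : (filterAlg est 0 s).law H =
        PMF.pure (∑ i, (s i).2 * (H.cell 0 (s i).1).card) := by
      rw [filterAlg, law_bind, law_seq]
      simp only [hest, indep_pure, PMF.pure_bind, law, hval]
    rw [hlaw, expect_pure, expect_pure]
    simp
  | succ r ih =>
    have hr' : r ≤ L := by omega
    set m : Fin k × (Fin d → Fin 2) → ℝ≥0 := fun i => (H.cell r (child (s i.1).1 i.2)).card with hm
    set x : Fin k × (Fin d → Fin 2) → ℝ≥0 := fun i => c r (child (s i.1).1 i.2) with hx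
    set w : Fin k × (Fin d → Fin 2) → ℝ≥0 := fun i => (s i.1).2 with hw
    have hZ : ∑ i, (s i).2 * (H.cell (r + 1) (s i).1).card = ∑ i, w i * m i := by
      rw [Fintype.sum_prod_type]
      refine Finset.sum_congr rfl fun i _ => ?_
      rw [card_cell_succ, Nat.cast_sum, Finset.mul_sum]
    have hcm : ∀ i, x i ≤ m i ∧ m i ≤ b * x i := fun i => hc r hr' _
    rw [filterAlg, law_bind, law_family_pure H fun i => hest r _, PMF.pure_bind, hZ]
    by_cases hS : ∑ i, w i * x i = 0
    · have hZ0 : ∑ i, w i * m i = 0 := by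
        refine Finset.sum_eq_zero fun i hi => ?_
        rcases mul_eq_zero.1 ((Finset.sum_eq_zero_iff.1 hS) i hi) with h | h
        · rw [h, zero_mul]
        · have : m i = 0 := by simpa [h] using (hcm i).2
          rw [this, mul_zero]
      rw [dif_pos hS, law, expect_pure, expect_pure, hZ0]
      simp
    · rw [dif_neg hS, law, expect_bind, expect_bind]
      obtain ⟨hA, hB⟩ := resampling_moments w x m hk hcm hS
      set S := ∑ i, w i * x i with hSdef
      set p := weighted (fun i => w i * x i) hS with hp
      set g : Fin k × (Fin d → Fin 2) → ℝ≥0 := fun i => S / (k * x i) * m i with hg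
      have hmean : (k : ℝ≥0∞) * p.expect (fun i => (g i : ℝ≥0∞)) =
          ((∑ i, w i * m i : ℝ≥0) : ℝ≥0∞) := by
        rw [hp, expect_weighted, ← hA]
        push_cast
        rfl
      constructor
      · calc _ = (indep fun _ : Fin k => p).expect (fun l => ∑ a, (g (l a) : ℝ≥0∞)) := by
              refine expect_congr _ fun l _ => ?_
              rw [(ih hr' _).1]
              push_cast
              rfl
          _ = _ := by
              rw [expect_indep_sum (fun _ : Fin k => p) fun _ i => (g i : ℝ≥0∞)]
              rw [Finset.sum_const, Finset.card_univ, Fintype.card_fin, nsmul_eq_mul, hmean]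
      · have hsq : (k : ℝ≥0∞) * p.expect (fun i => (g i : ℝ≥0∞) ^ 2) ≤
            ((b / k * (∑ i, w i * m i) ^ 2 : ℝ≥0) : ℝ≥0∞) := by
          have : p.expect (fun i => (g i : ℝ≥0∞) ^ 2) =
              p.expect (fun i => ((g i ^ 2 : ℝ≥0) : ℝ≥0∞)) := by
            congr 1
          rw [this, hp, expect_weighted]
          exact_mod_cast hB
        calc _ ≤ (indep fun _ : Fin k => p).expect (fun l =>
              (((1 + b / k) ^ r : ℝ≥0) : ℝ≥0∞) * (∑ a, (g (l a) : ℝ≥0∞)) ^ 2) := by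
              refine expect_mono _ fun l _ => ?_
              refine (ih hr' _).2.trans (le_of_eq ?_)
              push_cast
              rfl
          _ ≤ (((1 + b / k) ^ r : ℝ≥0) : ℝ≥0∞) *
              (((b / k * (∑ i, w i * m i) ^ 2 : ℝ≥0) : ℝ≥0∞) +
                ((∑ i, w i * m i : ℝ≥0) : ℝ≥0∞) ^ 2) := by
              rw [expect_const_mul]
              gcongr
              refine (expect_iid_sum_sq_le p fun i => (g i : ℝ≥0∞)).trans ?_
              rw [hmean]
              gcongr
          _ = (((1 + b / k) ^ r * (b / k * (∑ i, w i * m i) ^ 2 + (∑ i, w i * m i) ^ 2) : ℝ≥0) :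
                ℝ≥0∞) := by push_cast; rfl
          _ = _ := by
              congr 1
              ring

end Moments

/-! ### Amplification -/

open Classical in
/-- A value that agrees up to the relative error `η` with more than half of the given values, if
there is one. -/
noncomputable def agree {T : ℕ} (η : ℝ≥0) (z : Fin T → ℝ≥0) : ℝ≥0 :=
  if h : ∃ μ : ℝ≥0, T < 2 * (Finset.univ.filter fun a => |(z a : ℝ) - μ| ≤ η * μ).card then
    h.choose else 0

open Classical in
lemma agree_spec {T : ℕ} {η : ℝ≥0} (hη : η ≤ 1 / 2) {z : Fin T → ℝ≥0} {M : ℝ≥0}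
    (h : T < 2 * (Finset.univ.filter fun a => |(z a : ℝ) - M| ≤ η * M).card) :
    |(agree η z : ℝ) - M| ≤ 4 * η * M := by
  have hex : ∃ μ : ℝ≥0, T < 2 * (Finset.univ.filter fun a => |(z a : ℝ) - μ| ≤ η * μ).card :=
    ⟨M, h⟩
  rw [agree, dif_pos hex]
  have hμ := hex.choose_spec
  set μ := hex.choose
  -- Two majorities have a common element.
  obtain ⟨a, ha⟩ : ((Finset.univ.filter fun a => |(z a : ℝ) - M| ≤ η * M) ∩
      (Finset.univ.filter fun a => |(z a : ℝ) - μ| ≤ η * μ)).Nonempty := by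
    rw [← Finset.card_pos]
    have h1 := Finset.card_union_add_card_inter
      (Finset.univ.filter fun a => |(z a : ℝ) - M| ≤ η * M)
      (Finset.univ.filter fun a => |(z a : ℝ) - μ| ≤ η * μ)
    have h2 := Finset.card_le_univ ((Finset.univ.filter fun a => |(z a : ℝ) - M| ≤ η * M) ∪
      (Finset.univ.filter fun a => |(z a : ℝ) - μ| ≤ η * μ))
    rw [Fintype.card_fin] at h2
    omega
  simp only [Finset.mem_inter, Finset.mem_filter, Finset.mem_univ, true_and] at ha
  obtain ⟨h1, h2⟩ := ha
  rw [abs_le] at h1 h2 ⊢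
  have hη' : (η : ℝ) ≤ 1 / 2 := by exact_mod_cast hη
  have hM : (0 : ℝ) ≤ M := M.2
  have hμ0 : (0 : ℝ) ≤ μ := μ.2
  have hη0 : (0 : ℝ) ≤ η := η.2
  have hμM : (μ : ℝ) ≤ 3 * M := by nlinarith
  have : (η : ℝ) * μ ≤ η * (3 * M) := by gcongr
  constructor <;> linarith

/-- Estimate the size of a cell by `T` runs of the particle filter. -/
noncomputable def countAlg (est : ℕ → (Fin d → ℕ) → CIDAlgorithm V d ℝ≥0) (k T : ℕ) (η : ℝ≥0)
    (r : ℕ) (f : Fin d → ℕ) : CIDAlgorithm V d ℝ≥0 :=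
  (seq fun _ : Fin T => filterAlg est r fun _ : Fin k => (f, 1 / (k : ℝ≥0))).bind fun z =>
    output (agree η z)

lemma queriesAtMost_countAlg {est : ℕ → (Fin d → ℕ) → CIDAlgorithm V d ℝ≥0} {N : ℕ}
    (hest : ∀ r f, (est r f).QueriesAtMost N) (k T : ℕ) (η : ℝ≥0) (r : ℕ) (f : Fin d → ℕ) :
    (countAlg est k T η r f).QueriesAtMost (T * ((r + 1) * (k * 2 ^ d * N))) :=
  (QueriesAtMost.seq fun _ => queriesAtMost_filterAlg hest r _).bind (N' := 0) fun _ => trivial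

lemma one_add_pow_le {x : ℝ≥0} {r : ℕ} (h : 2 * (r * x) ≤ 1) : (1 + x) ^ r ≤ 1 + 2 * (r * x) := by
  induction r with
  | zero => simp
  | succ r ih =>
    have h' : 2 * (r * x) ≤ 1 := by
      refine le_trans ?_ h
      gcongr
      exact Nat.le_succ r
    calc (1 + x) ^ (r + 1) = (1 + x) ^ r * (1 + x) := pow_succ _ _
      _ ≤ (1 + 2 * (r * x)) * (1 + x) := by gcongr; exact ih h'
      _ = 1 + 2 * (r * x) + x + 2 * (r * x) * x := by ring
      _ ≤ 1 + 2 * (r * x) + x + 1 * x := by gcongr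
      _ = _ := by push_cast; ring

lemma toOuterMeasure_countAlg_le [Fintype V] {H : Hypergraph V}
    {est : ℕ → (Fin d → ℕ) → CIDAlgorithm V d ℝ≥0} {c : ℕ → (Fin d → ℕ) → ℝ≥0} {b η : ℝ≥0}
    {L T : ℕ} (hest : ∀ r f, (est r f).law H = PMF.pure (c r f)) (hk : k ≠ 0)
    (hc : ∀ r ≤ L, ∀ f, c r f ≤ (H.cell r f).card ∧ ((H.cell r f).card : ℝ≥0) ≤ b * c r f)
    (hη0 : 0 < η) (hη : η ≤ 1 / 2) (hkb : 32 * b * L ≤ η ^ 2 * k) {r : ℕ} (hr : r ≤ L)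
    (f : Fin d → ℕ) :
    ((countAlg est k T η r f).law H).toOuterMeasure
      {z | ¬ |(z : ℝ) - (H.cell r f).card| ≤ 4 * η * (H.cell r f).card} ≤ (1 / 2) ^ T := by
  classical
  set M : ℝ≥0 := ((H.cell r f).card : ℝ≥0) with hM
  have hk' : (k : ℝ≥0) ≠ 0 := by exact_mod_cast hk
  obtain ⟨hmean, hsq⟩ := filterAlg_moments hest hk hc hr fun _ : Fin k => (f, 1 / (k : ℝ≥0))
  have hsum : ∑ _i : Fin k, 1 / (k : ℝ≥0) * (H.cell r f).card = M := by
    rw [Finset.sum_const, Finset.card_univ, Fintype.card_fin, nsmul_eq_mul, ← hM]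
    field_simp
  simp only [hsum] at hmean hsq
  have hgrow : (1 + b / k) ^ r ≤ 1 + η ^ 2 / 16 := by
    have h32 : 2 * (r * (b / k)) ≤ η ^ 2 / 16 := by
      calc 2 * (r * (b / k)) ≤ 2 * (L * (b / k)) := by gcongr
        _ = (32 * b * L) / (16 * k) := by field_simp; ring
        _ ≤ (η ^ 2 * k) / (16 * k) := by gcongr
        _ = η ^ 2 / 16 := by field_simp
    have hη1 : η ^ 2 / 16 ≤ 1 := by
      rw [div_le_iff₀ (by norm_num), one_mul]
      calc η ^ 2 ≤ (1 / 2) ^ 2 := by gcongr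
        _ ≤ 16 := by rw [← NNReal.coe_le_coe]; norm_num
    exact (one_add_pow_le (h32.trans hη1)).trans (by gcongr)
  set P := (filterAlg est r fun _ : Fin k => (f, 1 / (k : ℝ≥0))).law H with hP
  set bad : Set ℝ≥0 := {z | ¬ |(z : ℝ) - M| ≤ η * M} with hbad
  have hdev : P.toOuterMeasure bad ≤ 1 / 16 := by
    refine (toOuterMeasure_deviation_le P (fun z => z) M η (η ^ 2 / 16) hη0 hmean
      (hsq.trans ?_)).trans ?_
    · rw [ENNReal.coe_le_coe]
      gcongr
    · have : η ^ 2 / 16 / η ^ 2 = 1 / 16 := by field_simp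
      rw [this]
      simp
  have hmaj := toOuterMeasure_iid_majority_le (n := T) P hdev
  rw [countAlg, law_bind, law_seq, toOuterMeasure_eq_expect, expect_bind]
  refine le_trans ?_ hmaj
  rw [toOuterMeasure_eq_expect]
  refine expect_mono _ fun z _ => ?_
  rw [law, expect_pure]
  by_cases hz : T ≤ 2 * (Finset.univ.filter fun a => z a ∈ bad).card
  · refine (Set.indicator_le_self' (fun _ _ => zero_le) _).trans ?_
    rw [Set.indicator_of_mem]
    · exact le_rfl
    · rw [Set.mem_ofPred_eq]
      convert hz
  · rw [Set.indicator_of_notMem]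
    · exact zero_le
    · refine not_not.2 ?_
      have hspec := agree_spec (T := T) hη (z := z) (M := M) (by
        have h := Finset.card_filter_add_card_filter_not (s := (Finset.univ : Finset (Fin T)))
          (fun a => |(z a : ℝ) - M| ≤ η * M)
        rw [Finset.card_univ, Fintype.card_fin] at h
        simp only [hbad, Set.mem_ofPred_eq] at hz
        omega)
      simpa [hM] using hspec

end CIDAlgorithm

/-! ### Sampling -/

namespace PMF

variable {α β : Type}

/-- Conditioning on a likely event: the conditional distribution, scaled by a lower bound on the
probability of the event, is below the unconditional one. -/
lemma exists_conditional (p : PMF α) {G : Set α} {δ : ℝ≥0∞} (h : p.toOuterMeasure Gᶜ ≤ δ)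
    (hδ : δ < 1) :
    ∃ D : PMF α, (∀ a, D a ≠ 0 → a ∈ G) ∧ ∀ a, (1 - δ) * D a ≤ p a := by
  have hG := p.one_sub_le_toOuterMeasure h
  have hpos : p.toOuterMeasure G ≠ 0 := fun h0 => by
    rw [h0, nonpos_iff_eq_zero, tsub_eq_zero_iff_le] at hG
    exact absurd hδ (not_lt.2 hG)
  have hex : ∃ a ∈ G, a ∈ p.support := by
    by_contra hcon
    push Not at hcon
    exact hpos ((p.toOuterMeasure_apply_eq_zero_iff G).2
      (Set.disjoint_left.2 fun a hp hG => hcon a hG hp))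
  refine ⟨p.filter G hex, fun a ha => ((p.filter_apply_ne_zero_iff hex a).1 ha).1, fun a => ?_⟩
  rw [PMF.filter_apply, ← PMF.toOuterMeasure_apply]
  calc (1 - δ) * (G.indicator p a * (p.toOuterMeasure G)⁻¹)
      ≤ p.toOuterMeasure G * (p a * (p.toOuterMeasure G)⁻¹) := by
        gcongr
        exact Set.indicator_le_self' (fun _ _ => zero_le) a
    _ = p a := by
        rw [mul_left_comm, ENNReal.mul_inv_cancel hpos
          (ne_top_of_le_ne_top ENNReal.one_ne_top (p.toOuterMeasure_le_one G)), mul_one]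

lemma mul_bind_le {p D : PMF α} {f g : α → PMF β} {x y : ℝ≥0∞} (h : ∀ a, x * D a ≤ p a)
    (hfg : ∀ a, D a ≠ 0 → ∀ b, y * g a b ≤ f a b) (b : β) :
    x * y * D.bind g b ≤ p.bind f b := by
  rw [PMF.bind_apply, PMF.bind_apply, ← ENNReal.tsum_mul_left]
  refine ENNReal.tsum_le_tsum fun a => ?_
  rcases eq_or_ne (D a) 0 with h0 | h0
  · simp [h0]
  · calc x * y * (D a * g a b) = (x * D a) * (y * g a b) := by ring
      _ ≤ _ := mul_le_mul' (h a) (hfg a h0 b)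

end PMF

namespace CIDAlgorithm

open Hypergraph PMF

variable {V : Type} {d : ℕ}

/-- Descend from a cell to a cell at level `0`, choosing among the children with probabilities
proportional to the estimates of their sizes by `cnt`. -/
noncomputable def walkAlg (cnt : ℕ → (Fin d → ℕ) → CIDAlgorithm V d ℝ≥0) :
    ℕ → (Fin d → ℕ) → CIDAlgorithm V d (Fin d → ℕ)
  | 0, f => output f
  | r + 1, f => (family fun u : Fin d → Fin 2 => cnt r (child f u)).bind fun z =>
      if h : ∑ u, z u = 0 then output f else
        draw (weighted z h) fun u => walkAlg cnt r (child f u)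

lemma queriesAtMost_walkAlg {cnt : ℕ → (Fin d → ℕ) → CIDAlgorithm V d ℝ≥0} {N L : ℕ}
    (hcnt : ∀ r < L, ∀ f, (cnt r f).QueriesAtMost N) {r : ℕ} (hr : r ≤ L) (f : Fin d → ℕ) :
    (walkAlg cnt r f).QueriesAtMost (r * (2 ^ d * N)) := by
  induction r generalizing f with
  | zero => trivial
  | succ r ih =>
    rw [walkAlg]
    refine ((QueriesAtMost.family fun u : Fin d → Fin 2 => hcnt r hr (child f u)).bind
      (N' := r * (2 ^ d * N)) fun z => ?_).mono ?_
    · split_ifs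
      · trivial
      · exact fun u _ => ih (by omega) _
    · simp only [Fintype.card_pi, Fintype.card_fin, Finset.prod_const, Finset.card_univ]
      exact le_of_eq (by ring)

lemma weighted_bounds {ι : Type} [Fintype ι] {m z : ι → ℝ≥0} {η lo hi : ℝ≥0} (hη : η < 1)
    (hlo : (lo : ℝ) * (1 + η) ≤ 1 - η) (hhi : (1 + η : ℝ) ≤ hi * (1 - η))
    (hz : ∀ i, |(z i : ℝ) - m i| ≤ η * m i) (h : ∑ i, z i ≠ 0) (i : ι) :
    (lo * m i : ℝ≥0) ≤ (∑ j, m j) * (z i / ∑ j, z j) ∧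
      (∑ j, m j) * (z i / ∑ j, z j) ≤ hi * m i := by
  have hz' := fun i => abs_le.1 (hz i)
  have hη' : (η : ℝ) < 1 := by exact_mod_cast hη
  have hSpos : (0 : ℝ) < ∑ j, (z j : ℝ) := by
    have : 0 < ∑ j, z j := pos_iff_ne_zero.2 h
    exact_mod_cast this
  have hSup : ∑ j, (z j : ℝ) ≤ (1 + η) * ∑ j, (m j : ℝ) := by
    rw [Finset.mul_sum]
    exact Finset.sum_le_sum fun j _ => by linarith [(hz' j).2]
  have hSlow : (1 - η) * ∑ j, (m j : ℝ) ≤ ∑ j, (z j : ℝ) := by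
    rw [Finset.mul_sum]
    exact Finset.sum_le_sum fun j _ => by linarith [(hz' j).1]
  have hm0 : (0 : ℝ) ≤ m i := (m i).2
  have hM0 : (0 : ℝ) ≤ ∑ j, (m j : ℝ) := Finset.sum_nonneg fun j _ => (m j).2
  have hlo0 : (0 : ℝ) ≤ lo := lo.2
  have hhi0 : (0 : ℝ) ≤ hi := hi.2
  have hzlow : (1 - η) * (m i : ℝ) ≤ z i := by linarith [(hz' i).1]
  have hzup : (z i : ℝ) ≤ (1 + η) * m i := by linarith [(hz' i).2]
  constructor
  · rw [← NNReal.coe_le_coe]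
    push_cast
    rw [← mul_div_assoc, le_div_iff₀ hSpos]
    calc (lo : ℝ) * m i * ∑ j, (z j : ℝ) ≤ lo * m i * ((1 + η) * ∑ j, (m j : ℝ)) := by gcongr
      _ = (lo * (1 + η)) * (m i * ∑ j, (m j : ℝ)) := by ring
      _ ≤ (1 - η) * (m i * ∑ j, (m j : ℝ)) := by gcongr
      _ = (∑ j, (m j : ℝ)) * ((1 - η) * m i) := by ring
      _ ≤ _ := by gcongr
  · rw [← NNReal.coe_le_coe]
    push_cast
    rw [← mul_div_assoc, div_le_iff₀ hSpos]
    calc (∑ j, (m j : ℝ)) * z i ≤ (∑ j, (m j : ℝ)) * ((1 + η) * m i) := by gcongr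
      _ = (1 + η) * (m i * ∑ j, (m j : ℝ)) := by ring
      _ ≤ (hi * (1 - η)) * (m i * ∑ j, (m j : ℝ)) := by gcongr
      _ = hi * m i * ((1 - η) * ∑ j, (m j : ℝ)) := by ring
      _ ≤ _ := by gcongr

/-- Conditioned on all estimates along the way being accurate, the descent ends in every tuple of
the cell with almost the same probability. Conditioning step by step keeps the reference
distribution `D` a probability distribution on the cell without any loss in the bounds. -/
lemma exists_walkAlg_near [Fintype V] {H : Hypergraph V}
    {cnt : ℕ → (Fin d → ℕ) → CIDAlgorithm V d ℝ≥0} {L : ℕ} {δ : ℝ≥0∞} {η lo hi : ℝ≥0}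
    (hη : η < 1) (hlo : (lo : ℝ) * (1 + η) ≤ 1 - η) (hhi : (1 + η : ℝ) ≤ hi * (1 - η))
    (hδ : 2 ^ d * δ < 1)
    (hcnt : ∀ r < L, ∀ f, ((cnt r f).law H).toOuterMeasure
      {z | ¬ |(z : ℝ) - (H.cell r f).card| ≤ η * (H.cell r f).card} ≤ δ)
    {r : ℕ} (hr : r ≤ L) (f : Fin d → ℕ) (hf : (H.cell r f).card ≠ 0) :
    ∃ D : PMF (Fin d → ℕ),
      (∀ x, (1 - 2 ^ d * δ) ^ r * D x ≤ (walkAlg cnt r f).law H x) ∧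
      (∀ x, D x ≠ 0 → ∃ t ∈ H.cell r f, (fun j => code (t j)) = x) ∧
      ∀ t ∈ H.cell r f, (lo : ℝ≥0∞) ^ r ≤ (H.cell r f).card * D (fun j => code (t j)) ∧
        (H.cell r f).card * D (fun j => code (t j)) ≤ (hi : ℝ≥0∞) ^ r := by
  classical
  induction r generalizing f with
  | zero =>
    have hcode : ∀ t ∈ H.cell 0 f, (fun j => code (t j)) = f := fun t ht => funext fun j => by
      simpa using (mem_cell.1 ht).2.2 j
    have h1 : (H.cell 0 f).card = 1 := by
      have := card_cell_zero_le H f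
      omega
    refine ⟨PMF.pure f, fun x => ?_, fun x hx => ?_, fun t ht => ?_⟩
    · rw [walkAlg, law, pow_zero, one_mul]
    · obtain ⟨t, ht⟩ := Finset.card_pos.1 (Nat.pos_of_ne_zero hf)
      have hxf : x = f := by
        by_contra hne
        exact hx (PMF.pure_apply_of_ne _ _ hne)
      exact ⟨t, ht, (hcode t ht).trans hxf.symm⟩
    · rw [hcode t ht, h1]
      simp
  | succ r ih =>
    have hr' : r < L := hr
    set m : (Fin d → Fin 2) → ℝ≥0 := fun u => ((H.cell r (child f u)).card : ℝ≥0) with hm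
    have hM : ((H.cell (r + 1) f).card : ℝ≥0) = ∑ u, m u := by
      rw [card_cell_succ]
      push_cast
      rfl
    set G : Set ((Fin d → Fin 2) → ℝ≥0) := {z | ∀ u, |(z u : ℝ) - m u| ≤ η * m u} with hG
    set p := (family fun u : Fin d → Fin 2 => cnt r (child f u)).law H with hp
    have hbad : p.toOuterMeasure Gᶜ ≤ 2 ^ d * δ := by
      have hsub : Gᶜ ⊆ ⋃ u ∈ (Finset.univ : Finset (Fin d → Fin 2)),
          {z | z u ∈ {y : ℝ≥0 | ¬ |(y : ℝ) - (H.cell r (child f u)).card| ≤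
            η * (H.cell r (child f u)).card}} := by
        intro z hz
        have hz' : ¬ ∀ u, |(z u : ℝ) - m u| ≤ η * m u := hz
        obtain ⟨u, hu⟩ := not_forall.1 hz'
        simp only [Finset.mem_univ, Set.iUnion_true, Set.mem_iUnion]
        exact ⟨u, by simpa [hm] using hu⟩
      refine ((MeasureTheory.measure_mono hsub).trans
        (MeasureTheory.measure_biUnion_finset_le _ _)).trans ?_
      calc _ ≤ ∑ _u : Fin d → Fin 2, δ := by
            refine Finset.sum_le_sum fun u _ => ?_
            rw [hp, law_family_coord]
            exact hcnt r hr' _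
        _ = 2 ^ d * δ := by simp
    obtain ⟨E, hEG, hEp⟩ := exists_conditional p hbad hδ
    have hD : ∀ u, ∃ D : PMF (Fin d → ℕ), (H.cell r (child f u)).card ≠ 0 →
        (∀ x, (1 - 2 ^ d * δ) ^ r * D x ≤ (walkAlg cnt r (child f u)).law H x) ∧
        (∀ x, D x ≠ 0 → ∃ t ∈ H.cell r (child f u), (fun j => code (t j)) = x) ∧
        ∀ t ∈ H.cell r (child f u),
          (lo : ℝ≥0∞) ^ r ≤ (H.cell r (child f u)).card * D (fun j => code (t j)) ∧
          (H.cell r (child f u)).card * D (fun j => code (t j)) ≤ (hi : ℝ≥0∞) ^ r := by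
      intro u
      by_cases hu : (H.cell r (child f u)).card = 0
      · exact ⟨PMF.pure f, fun h => absurd hu h⟩
      · obtain ⟨D, hD⟩ := ih hr'.le (child f u) hu
        exact ⟨D, fun _ => hD⟩
    choose D hD using hD
    have hzpos : ∀ z ∈ G, ∑ u, z u ≠ 0 := by
      intro z hz h0
      have hM0 : ∑ u, m u = 0 := by
        refine Finset.sum_eq_zero fun u hu => ?_
        have hzu : z u = 0 := (Finset.sum_eq_zero_iff.1 h0) u hu
        have h1 : |(z u : ℝ) - m u| ≤ η * m u := hz u
        rw [hzu, NNReal.coe_zero, zero_sub, abs_neg, NNReal.abs_eq] at h1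
        have hη' : (η : ℝ) < 1 := by exact_mod_cast hη
        have h2 : (0 : ℝ) ≤ m u := (m u).2
        have h3 : (m u : ℝ) = 0 := by nlinarith
        exact_mod_cast h3
      rw [← hM] at hM0
      exact hf (by exact_mod_cast hM0)
    have hchild : ∀ z ∈ G, ∀ u, z u ≠ 0 → (H.cell r (child f u)).card ≠ 0 := by
      intro z hz u hu h0
      have h1 : |(z u : ℝ) - m u| ≤ η * m u := hz u
      have h2 : m u = 0 := by simp [hm, h0]
      rw [h2] at h1
      simp only [NNReal.coe_zero, sub_zero, mul_zero, abs_nonpos_iff, NNReal.coe_eq_zero] at h1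
      exact hu h1
    set F : ((Fin d → Fin 2) → ℝ≥0) → PMF (Fin d → ℕ) := fun z =>
      if h : ∑ u, z u = 0 then PMF.pure f else (weighted z h).bind D with hF
    have hwz : ∀ (z : (Fin d → Fin 2) → ℝ≥0) (h : ∑ u, z u ≠ 0) u, weighted z h u ≠ 0 →
        z u ≠ 0 := by
      intro z h u hu h0
      exact hu (by rw [weighted_apply, h0, zero_div, ENNReal.coe_zero])
    refine ⟨E.bind F, fun x => ?_, fun x hx => ?_, fun t ht => ?_⟩
    · rw [walkAlg, law_bind, pow_succ']
      refine mul_bind_le hEp (fun z hz y => ?_) x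
      have hzG := hEG z hz
      simp only [hF, dif_neg (hzpos z hzG)]
      rw [law]
      have := mul_bind_le (p := weighted z (hzpos z hzG)) (D := weighted z (hzpos z hzG))
        (x := 1) (y := (1 - 2 ^ d * δ) ^ r) (f := fun u => (walkAlg cnt r (child f u)).law H)
        (g := D) (fun a => (one_mul _).le)
        (fun u hu => (hD u (hchild z hzG u (hwz z _ u hu))).1) y
      rwa [one_mul] at this
    · obtain ⟨z, hz, hzx⟩ := (PMF.mem_support_bind_iff _ _ _).1 ((PMF.mem_support_iff _ _).2 hx)
      have hzG := hEG z hz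
      simp only [hF, dif_neg (hzpos z hzG)] at hzx
      obtain ⟨u, hu, hux⟩ := (PMF.mem_support_bind_iff _ _ _).1 hzx
      obtain ⟨t, ht, htx⟩ := (hD u (hchild z hzG u (hwz z _ u hu))).2.1 x hux
      exact ⟨t, (mem_cell_child.1 ht).1, htx⟩
    · set u₀ : Fin d → Fin 2 := fun j => Fin.ofNat 2 (code (t j) / 2 ^ r) with hu₀
      have ht₀ : t ∈ H.cell r (child f u₀) := mem_cell_child.2 ⟨ht, rfl⟩
      have hne₀ : (H.cell r (child f u₀)).card ≠ 0 := Finset.card_ne_zero_of_mem ht₀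
      obtain ⟨-, -, hb⟩ := hD u₀ hne₀
      obtain ⟨hb1, hb2⟩ := hb t ht₀
      set x : Fin d → ℕ := fun j => code (t j) with hx
      -- Only the child that contains `t` can lead to `t`.
      have hval : ((H.cell (r + 1) f).card : ℝ≥0∞) * E.bind F x =
          E.expect (fun z => ((∑ u, m u) * (z u₀ / ∑ u, z u) : ℝ≥0)) * D u₀ x := by
        rw [PMF.bind_apply, ← expect_mul_const]
        change _ * E.expect (fun z => F z x) = _
        rw [← expect_const_mul]
        refine expect_congr _ fun z hz => ?_
        have hzG := hEG z hz
        simp only [hF, dif_neg (hzpos z hzG)]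
        rw [PMF.bind_apply, tsum_eq_single u₀]
        · rw [weighted_apply, ← mul_assoc, ← hM]
          push_cast
          rfl
        · intro u hu
          by_contra hcon
          obtain ⟨hcon1, hcon2⟩ := mul_ne_zero_iff.1 hcon
          obtain ⟨t', ht', htx⟩ := (hD u (hchild z hzG u (hwz z _ u hcon1))).2.1 x hcon2
          have htt : t' = t := funext fun j => code_injective (congrFun htx j)
          rw [htt] at ht'
          exact hu (mem_cell_child.1 ht').2.symm
      rw [hval]
      have hmu : ((m u₀ : ℝ≥0) : ℝ≥0∞) = (H.cell r (child f u₀)).card := by simp [hm]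
      constructor
      · calc (lo : ℝ≥0∞) ^ (r + 1) = lo * lo ^ r := pow_succ' _ _
          _ ≤ lo * (m u₀ * D u₀ x) := by
              rw [hmu]
              gcongr
          _ = ((lo * m u₀ : ℝ≥0) : ℝ≥0∞) * D u₀ x := by
              push_cast
              ring
          _ ≤ _ := by
              rw [← E.expect_const ((lo * m u₀ : ℝ≥0) : ℝ≥0∞)]
              gcongr
              refine expect_mono _ fun z hz => ENNReal.coe_le_coe.2 ?_
              exact (weighted_bounds hη hlo hhi (hEG z hz) (hzpos z (hEG z hz)) u₀).1
      · calc _ ≤ ((hi * m u₀ : ℝ≥0) : ℝ≥0∞) * D u₀ x := by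
              rw [← E.expect_const ((hi * m u₀ : ℝ≥0) : ℝ≥0∞)]
              gcongr
              refine expect_mono _ fun z hz => ENNReal.coe_le_coe.2 ?_
              exact (weighted_bounds hη hlo hhi (hEG z hz) (hzpos z (hEG z hz)) u₀).2
          _ = hi * (m u₀ * D u₀ x) := by
              push_cast
              ring
          _ ≤ hi * hi ^ r := by
              rw [hmu]
              gcongr
          _ = _ := (pow_succ' _ _).symm

end CIDAlgorithm

/-! ### From tuples back to hyperedges -/

namespace Hypergraph

open PMF

variable {V : Type} [Fintype V] {d : ℕ}

open Classical in
/-- The enumerations of a vertex set without repetitions. -/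
noncomputable def enumerations (d : ℕ) (e : Set V) : Finset (Fin d → V) :=
  Finset.univ.filter fun t => Function.Injective t ∧ Set.range t = e

lemma mem_enumerations {e : Set V} {t : Fin d → V} :
    t ∈ enumerations d e ↔ Function.Injective t ∧ Set.range t = e := by
  simp [enumerations]

lemma card_enumerations {e : Set V} (he : e.ncard = d) :
    (enumerations d e).card = d.factorial := by
  classical
  have hcard : Fintype.card e = d := by rw [← he, Set.ncard_eq_toFinset_card', Set.toFinset_card]
  have himage : enumerations d e = Finset.univ.image fun (t : Fin d ↪ e) j => (t j : V) := by
    ext t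
    rw [mem_enumerations, Finset.mem_image]
    constructor
    · rintro ⟨hinj, hrange⟩
      refine ⟨⟨fun j => ⟨t j, hrange ▸ ⟨j, rfl⟩⟩, fun i j hij => hinj (Subtype.ext_iff.1 hij)⟩,
        Finset.mem_univ _, rfl⟩
    · rintro ⟨s, -, rfl⟩
      have hinj : Function.Injective fun j => (s j : V) :=
        Subtype.val_injective.comp s.injective
      refine ⟨hinj, Set.eq_of_subset_of_ncard_le ?_ ?_ (Set.toFinite _)⟩
      · rintro _ ⟨j, rfl⟩
        exact (s j).2
      · rw [he, Set.ncard_range_of_injective hinj, Nat.card_eq_fintype_card, Fintype.card_fin]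
  rw [himage, Finset.card_image_of_injective, Finset.card_univ, Fintype.card_embedding_eq, hcard,
    Fintype.card_fin, Nat.descFactorial_self]
  intro s t hst
  ext j
  exact congrFun hst j

lemma mem_cell_root {H : Hypergraph V} {L : ℕ} (hL : Fintype.card V ≤ 2 ^ L) {t : Fin d → V} :
    t ∈ H.cell L (fun _ => 0) ↔ Function.Injective t ∧ Set.range t ∈ H.edgeSet := by
  rw [mem_cell]
  refine and_congr_right fun _ => and_iff_left fun j => Nat.div_eq_of_lt ?_
  exact (code_lt _).trans_le hL

lemma card_cell_root {H : Hypergraph V} (hH : H.IsUniform d) {L : ℕ}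
    (hL : Fintype.card V ≤ 2 ^ L) :
    (H.cell L fun _ : Fin d => 0).card = d.factorial * H.numEdges := by
  classical
  rw [Finset.card_eq_sum_card_fiberwise (f := fun t => Set.range t) (t := H.edgeSet.toFinset)
    (fun t ht => by simpa using ((mem_cell_root hL).1 (Finset.mem_coe.1 ht)).2)]
  rw [Finset.sum_congr rfl (g := fun _ => d.factorial), Finset.sum_const, smul_eq_mul, mul_comm,
    numEdges, Set.ncard_eq_toFinset_card']
  intro e he
  have he' : e ∈ H.edgeSet := Set.mem_toFinset.1 he
  rw [← card_enumerations (hH e he')]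
  congr 1
  ext t
  rw [Finset.mem_filter, mem_cell_root hL, mem_enumerations]
  constructor
  · rintro ⟨⟨h1, -⟩, h2⟩
    exact ⟨h1, h2⟩
  · rintro ⟨h1, h2⟩
    exact ⟨⟨h1, h2 ▸ he'⟩, h2⟩

/-- The set of the vertices with the given numbers. -/
def decode (x : Fin d → ℕ) : Set V := {v | ∃ j, code v = x j}

lemma decode_code (t : Fin d → V) : decode (fun j => code (t j)) = Set.range t := by
  ext v
  constructor
  · rintro ⟨j, hj⟩
    exact ⟨j, (code_injective hj).symm⟩
  · rintro ⟨j, rfl⟩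
    exact ⟨j, rfl⟩

/-- A hyperedge collects the probabilities of its enumerations. -/
lemma map_decode_apply {H : Hypergraph V} {L : ℕ} (hL : Fintype.card V ≤ 2 ^ L)
    (D : PMF (Fin d → ℕ))
    (hD : ∀ x, D x ≠ 0 → ∃ t ∈ H.cell L (fun _ : Fin d => 0), (fun j => code (t j)) = x)
    (e : Set V) :
    D.map decode e = ∑ t ∈ enumerations d e, D fun j => code (t j) := by
  classical
  rw [PMF.map_apply, tsum_eq_sum (s := (enumerations d e).image fun t j => code (t j)),
    Finset.sum_image]
  · refine Finset.sum_congr rfl fun t ht => ?_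
    rw [if_pos]
    rw [decode_code, (mem_enumerations.1 ht).2]
  · intro s _ t _ hst
    exact funext fun j => code_injective (congrFun hst j)
  · intro x hx
    split_ifs with he
    · by_contra hne
      obtain ⟨t, ht, rfl⟩ := hD x hne
      refine hx (Finset.mem_image.2 ⟨t, mem_enumerations.2 ⟨((mem_cell_root hL).1 ht).1, ?_⟩, rfl⟩)
      rw [he, decode_code]
    · rfl

end Hypergraph

/-! ### Mixtures -/

namespace PMF

variable {β : Type}

/-- A distribution that lies above `(1 - t) * D` is a mixture of `D` and another distribution. -/
lemma exists_mixture (P D : PMF β) {t : ℝ} (ht : 0 < t) (ht1 : t ≤ 1)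
    (h : ∀ e, ENNReal.ofReal (1 - t) * D e ≤ P e) :
    ∃ R : PMF β, ∀ e, (P e).toReal = (1 - t) * (D e).toReal + t * (R e).toReal := by
  have hts : ENNReal.ofReal (1 - t) + ENNReal.ofReal t = 1 := by
    rw [← ENNReal.ofReal_add (by linarith) ht.le]
    simp
  have ht0 : ENNReal.ofReal t ≠ 0 := by simpa using ht
  have hsum : ∑' e, (P e - ENNReal.ofReal (1 - t) * D e) = ENNReal.ofReal t := by
    have h1 : ∑' e, (P e - ENNReal.ofReal (1 - t) * D e) + ENNReal.ofReal (1 - t) = 1 := by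
      calc _ = ∑' e, (P e - ENNReal.ofReal (1 - t) * D e) +
            ∑' e, ENNReal.ofReal (1 - t) * D e := by
            rw [ENNReal.tsum_mul_left, D.tsum_coe, mul_one]
        _ = ∑' e, P e := by
            rw [← ENNReal.tsum_add]
            exact tsum_congr fun e => tsub_add_cancel_of_le (h e)
        _ = 1 := P.tsum_coe
    rw [← hts, add_comm] at h1
    exact (ENNReal.add_right_inj ENNReal.ofReal_ne_top).1 h1
  refine ⟨⟨fun e => (P e - ENNReal.ofReal (1 - t) * D e) * (ENNReal.ofReal t)⁻¹,
    ENNReal.summable.hasSum_iff.2 ?_⟩, fun e => ?_⟩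
  · rw [ENNReal.tsum_mul_right, hsum, ENNReal.mul_inv_cancel ht0 ENNReal.ofReal_ne_top]
  · change _ = _ + t * ((P e - ENNReal.ofReal (1 - t) * D e) * (ENNReal.ofReal t)⁻¹).toReal
    rw [ENNReal.toReal_mul, ENNReal.toReal_sub_of_le (h e) (P.apply_ne_top e), ENNReal.toReal_inv,
      ENNReal.toReal_ofReal ht.le, ENNReal.toReal_mul, ENNReal.toReal_ofReal (by linarith)]
    field_simp
    ring

lemma one_sub_add_le_mul {x y : ℝ≥0∞} : 1 - (x + y) ≤ (1 - x) * (1 - y) := by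
  rw [ENNReal.sub_mul (fun _ _ => (tsub_le_self.trans_lt ENNReal.one_lt_top).ne), one_mul,
    add_comm, ← tsub_tsub]
  refine tsub_le_tsub_left ?_ _
  exact mul_le_of_le_one_right zero_le tsub_le_self

lemma one_sub_mul_le_pow (r : ℕ) (y : ℝ≥0∞) : 1 - r * y ≤ (1 - y) ^ r := by
  induction r with
  | zero => simp
  | succ r ih =>
    calc 1 - ((r + 1 : ℕ) : ℝ≥0∞) * y = 1 - (r * y + y) := by push_cast; rw [add_mul, one_mul]
      _ ≤ (1 - r * y) * (1 - y) := one_sub_add_le_mul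
      _ ≤ (1 - y) ^ r * (1 - y) := by gcongr
      _ = _ := (pow_succ _ _).symm

end PMF

/-! ### The estimator and the sampler -/

namespace CIDAlgorithm

open Hypergraph PMF

variable {V : Type} [Fintype V] {d : ℕ} [NeZero d]

/-- The estimator: draw the seeds of the coarse estimator once, estimate the number of enumerations
of hyperedges, and divide by `d !`. -/
noncomputable def estimateAlg (V : Type) [Fintype V] (d : ℕ) [NeZero d] (L R T k : ℕ) (η : ℝ≥0) :
    CIDAlgorithm V d ℝ :=
  draw (indep fun _ : Fin T => indep fun _ : Fin R => seedLaw V d L) fun ω =>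
    (countAlg (coarseAlg ω) k T η L fun _ => 0).bind fun z => output ((z : ℝ) / d.factorial)

/-- The sampler: draw the seeds of the coarse estimator once, descend to a single tuple, and report
the set of its entries. -/
noncomputable def sampleAlg (V : Type) [Fintype V] (d : ℕ) [NeZero d] (L R T k : ℕ) (η : ℝ≥0) :
    CIDAlgorithm V d (Set V) :=
  draw (indep fun _ : Fin T => indep fun _ : Fin R => seedLaw V d L) fun ω =>
    (walkAlg (countAlg (coarseAlg ω) k T η) L fun _ => 0).bind fun x => output (decode x)

lemma queriesAtMost_estimateAlg (L R T k : ℕ) (η : ℝ≥0) :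
    (estimateAlg V d L R T k η).QueriesAtMost
      (T * ((L + 1) * (k * 2 ^ d * ((L + 1) ^ d * (T * R))))) :=
  fun _ _ => (queriesAtMost_countAlg (queriesAtMost_coarseAlg _) k T η L _).bind (N' := 0)
    fun _ => trivial

lemma queriesAtMost_sampleAlg (L R T k : ℕ) (η : ℝ≥0) :
    (sampleAlg V d L R T k η).QueriesAtMost
      (L * (2 ^ d * (T * ((L + 1) * (k * 2 ^ d * ((L + 1) ^ d * (T * R))))))) := by
  intro ω _
  refine (queriesAtMost_walkAlg (fun r hr f => ?_) le_rfl _).bind (N' := 0) fun _ => trivial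
  refine (queriesAtMost_countAlg (queriesAtMost_coarseAlg ω) k T η r f).mono ?_
  gcongr

section Correctness

variable {H : Hypergraph V} {L R T k : ℕ} {η : ℝ≥0} {δ : ℝ≥0∞}

lemma toOuterMeasure_estimateAlg_le (hH : H.IsUniform d) (hL : Fintype.card V ≤ 2 ^ L)
    (hR : 5 * (4 * d * (L + 1)) ^ d ≤ R) (hk : k ≠ 0) (hη0 : 0 < η) (hη : η ≤ 1 / 2)
    (hkb : 32 * (80 * ((4 * d * (L + 1)) ^ d : ℕ)) * L ≤ η ^ 2 * k)
    (hδ : ((L + 1) * Fintype.card V ^ d * ((L + 1) ^ d * (R + 1)) : ℕ) * (1 / 2 : ℝ≥0∞) ^ T ≤ δ) :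
    ((estimateAlg V d L R T k η).law H).toOuterMeasure
      {x : ℝ | |(H.numEdges : ℝ) - x| ≤ 4 * η * H.numEdges}ᶜ ≤ δ + (1 / 2) ^ T := by
  rw [estimateAlg, law]
  refine toOuterMeasure_bind_le _ _ _ {ω | GoodSeeds H ((4 * d * (L + 1)) ^ d) ω}
    (le_trans (MeasureTheory.measure_mono ?_) ((toOuterMeasure_not_goodSeeds_le hH hL hR).trans hδ))
    fun ω hω => ?_
  · intro ω hω
    exact hω
  · have h := toOuterMeasure_countAlg_le (L := L) (T := T) (law_coarseAlg H ω) hk hω hη0 hη hkb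
      le_rfl fun _ => 0
    refine le_trans ?_ h
    rw [law_bind, toOuterMeasure_eq_expect, toOuterMeasure_eq_expect, expect_bind]
    refine expect_mono _ fun z _ => ?_
    rw [law, expect_pure]
    by_cases hz : |(z : ℝ) - (H.cell L fun _ : Fin d => 0).card| ≤
        4 * η * (H.cell L fun _ : Fin d => 0).card
    · rw [Set.indicator_of_notMem]
      · exact zero_le
      · refine not_not.2 ?_
        rw [card_cell_root hH hL] at hz
        push_cast at hz
        have hd : (0 : ℝ) < d.factorial := by exact_mod_cast d.factorial_pos
        have h1 : (H.numEdges : ℝ) - z / d.factorial =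
            -((z - d.factorial * H.numEdges) / d.factorial) := by
          field_simp
          ring
        change |(H.numEdges : ℝ) - z / d.factorial| ≤ 4 * η * H.numEdges
        rw [h1, abs_neg, abs_div, abs_of_pos hd, div_le_iff₀ hd]
        linarith
    · refine (Set.indicator_le_self' (fun _ _ => zero_le) _).trans ?_
      rw [Set.indicator_of_mem]
      · exact le_rfl
      · exact hz

lemma exists_sampleAlg_near (hH : H.IsUniform d) (hL : Fintype.card V ≤ 2 ^ L)
    (hR : 5 * (4 * d * (L + 1)) ^ d ≤ R) (hk : k ≠ 0) (hη0 : 0 < η) (hη : 8 * η ≤ 1)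
    (hkb : 32 * (80 * ((4 * d * (L + 1)) ^ d : ℕ)) * L ≤ η ^ 2 * k)
    (hδ : ((L + 1) * Fintype.card V ^ d * ((L + 1) ^ d * (R + 1)) : ℕ) * (1 / 2 : ℝ≥0∞) ^ T ≤ δ)
    (hδ1 : δ < 1) (hT : 2 ^ d * (1 / 2 : ℝ≥0∞) ^ T < 1) (hne : H.edgeSet.Nonempty) :
    ∃ D : PMF (Set V),
      (∀ e, (1 - (δ + L * (2 ^ d * (1 / 2) ^ T))) * D e ≤
        (sampleAlg V d L R T k η).law H e) ∧
      D.support ⊆ H.edgeSet ∧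
      ∀ e ∈ H.edgeSet, ((1 - 8 * η : ℝ≥0) : ℝ≥0∞) ^ L ≤ H.numEdges * D e ∧
        H.numEdges * D e ≤ ((1 + 16 * η : ℝ≥0) : ℝ≥0∞) ^ L := by
  classical
  set p := indep fun _ : Fin T => indep fun _ : Fin R => seedLaw V d L with hp
  have hm : H.numEdges ≠ 0 := by
    rw [numEdges, ← Nat.pos_iff_ne_zero, Set.ncard_pos (Set.toFinite _)]
    exact hne
  have hroot := card_cell_root hH hL
  have hroot0 : (H.cell L fun _ : Fin d => 0).card ≠ 0 := by
    rw [hroot]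
    exact mul_ne_zero d.factorial_ne_zero hm
  have hηR : (η : ℝ) ≤ 1 / 8 := by
    have : (8 : ℝ) * η ≤ 1 := by exact_mod_cast hη
    linarith
  have hη0R : (0 : ℝ) < η := hη0
  have hη2 : η ≤ 1 / 2 := by
    rw [← NNReal.coe_le_coe]
    push_cast
    linarith
  -- The estimates have relative error `4 * η`, so the ratio of an estimate to the sum of the
  -- estimates is correct up to factors between `1 - 8 * η` and `1 + 16 * η`.
  have hlo : ((1 - 8 * η : ℝ≥0) : ℝ) * (1 + (4 * η : ℝ≥0)) ≤ 1 - (4 * η : ℝ≥0) := by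
    rw [NNReal.coe_sub hη]
    push_cast
    nlinarith
  have hhi : (1 + (4 * η : ℝ≥0) : ℝ) ≤ ((1 + 16 * η : ℝ≥0) : ℝ) * (1 - (4 * η : ℝ≥0)) := by
    push_cast
    nlinarith
  have hη1 : 4 * η < 1 := by
    rw [← NNReal.coe_lt_coe]
    push_cast
    linarith
  obtain ⟨E, hEG, hEp⟩ := exists_conditional p
    (G := {ω | GoodSeeds H ((4 * d * (L + 1)) ^ d) ω}) (δ := δ)
    (le_trans (MeasureTheory.measure_mono fun ω hω => hω)
      ((toOuterMeasure_not_goodSeeds_le hH hL hR).trans hδ)) hδ1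
  have hwalk : ∀ ω : Fin T → Fin R → Seed V d L, ∃ D : PMF (Fin d → ℕ),
      GoodSeeds H ((4 * d * (L + 1)) ^ d) ω →
      (∀ x, (1 - 2 ^ d * (1 / 2) ^ T) ^ L * D x ≤
        (walkAlg (countAlg (coarseAlg ω) k T η) L fun _ => 0).law H x) ∧
      (∀ x, D x ≠ 0 → ∃ t ∈ H.cell L (fun _ : Fin d => 0), (fun j => code (t j)) = x) ∧
      ∀ t ∈ H.cell L (fun _ : Fin d => 0),
        ((1 - 8 * η : ℝ≥0) : ℝ≥0∞) ^ L ≤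
          (H.cell L fun _ : Fin d => 0).card * D (fun j => code (t j)) ∧
        (H.cell L fun _ : Fin d => 0).card * D (fun j => code (t j)) ≤
          ((1 + 16 * η : ℝ≥0) : ℝ≥0∞) ^ L := by
    intro ω
    by_cases hω : GoodSeeds H ((4 * d * (L + 1)) ^ d) ω
    · obtain ⟨D, hD⟩ := exists_walkAlg_near (H := H) (L := L) hη1 hlo hhi hT (fun r hr f => by
        have := toOuterMeasure_countAlg_le (T := T) (law_coarseAlg H ω) hk hω hη0 hη2 hkb hr.le f
        simpa using this) le_rfl (fun _ => 0) hroot0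
      exact ⟨D, fun _ => hD⟩
    · exact ⟨PMF.pure 0, fun h => absurd h hω⟩
  choose D hD using hwalk
  have hsupp : ∀ x, E.bind D x ≠ 0 →
      ∃ t ∈ H.cell L (fun _ : Fin d => 0), (fun j => code (t j)) = x := by
    intro x hx
    obtain ⟨ω, hω, hωx⟩ := (PMF.mem_support_bind_iff _ _ _).1 ((PMF.mem_support_iff _ _).2 hx)
    exact (hD ω (hEG ω hω)).2.1 x hωx
  have hbound : ∀ t ∈ H.cell L (fun _ : Fin d => 0),
      ((1 - 8 * η : ℝ≥0) : ℝ≥0∞) ^ L ≤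
        (H.cell L fun _ : Fin d => 0).card * E.bind D (fun j => code (t j)) ∧
      (H.cell L fun _ : Fin d => 0).card * E.bind D (fun j => code (t j)) ≤
        ((1 + 16 * η : ℝ≥0) : ℝ≥0∞) ^ L := by
    intro t ht
    have hval : ((H.cell L fun _ : Fin d => 0).card : ℝ≥0∞) * E.bind D (fun j => code (t j)) =
        E.expect fun ω => (H.cell L fun _ : Fin d => 0).card * D ω (fun j => code (t j)) := by
      rw [expect_const_mul]
      rfl
    rw [hval]
    constructor
    · rw [← E.expect_const (((1 - 8 * η : ℝ≥0) : ℝ≥0∞) ^ L)]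
      exact expect_mono _ fun ω hω => ((hD ω (hEG ω hω)).2.2 t ht).1
    · rw [← E.expect_const (((1 + 16 * η : ℝ≥0) : ℝ≥0∞) ^ L)]
      exact expect_mono _ fun ω hω => ((hD ω (hEG ω hω)).2.2 t ht).2
  refine ⟨(E.bind D).map decode, fun e => ?_, fun e he => ?_, fun e he => ?_⟩
  · have h1 : ∀ x, (1 - δ) * (1 - 2 ^ d * (1 / 2) ^ T) ^ L * E.bind D x ≤
        p.bind (fun ω => (walkAlg (countAlg (coarseAlg ω) k T η) L fun _ => 0).law H) x :=
      fun x => mul_bind_le hEp (fun ω hω => (hD ω (hEG ω hω)).1) x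
    have hlaw : (sampleAlg V d L R T k η).law H =
        (p.bind fun ω => (walkAlg (countAlg (coarseAlg ω) k T η) L fun _ => 0).law H).map
          decode := by
      rw [sampleAlg, law, PMF.map_bind]
      congr 1
      funext ω
      rw [law_bind]
      rfl
    rw [hlaw]
    have h2 := mul_bind_le h1 (f := fun x => PMF.pure (decode x : Set V))
      (g := fun x => PMF.pure (decode x)) (y := 1) (fun x _ b => (one_mul _).le) e
    rw [mul_one] at h2
    refine le_trans ?_ h2
    change _ * (E.bind D).bind (fun x => PMF.pure (decode x)) e ≤ _
    gcongr
    refine one_sub_add_le_mul.trans ?_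
    gcongr
    exact one_sub_mul_le_pow L _
  · rw [PMF.mem_support_iff, map_decode_apply hL _ hsupp] at he
    obtain ⟨t, ht, hne⟩ := Finset.exists_ne_zero_of_sum_ne_zero he
    obtain ⟨s, hs, hst⟩ := hsupp _ hne
    have hst' : s = t := funext fun j => code_injective (congrFun hst j)
    rw [← (mem_enumerations.1 ht).2, ← hst']
    exact ((mem_cell_root hL).1 hs).2
  · have hcard := card_enumerations (d := d) (hH e he)
    have hmem : ∀ t ∈ enumerations d e, t ∈ H.cell L (fun _ : Fin d => 0) := fun t ht =>
      (mem_cell_root hL).2 ⟨(mem_enumerations.1 ht).1, (mem_enumerations.1 ht).2 ▸ he⟩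
    have hfac : ((d.factorial : ℕ) : ℝ≥0∞) ≠ 0 := by exact_mod_cast d.factorial_ne_zero
    have hfac' : ((d.factorial : ℕ) : ℝ≥0∞) ≠ ⊤ := ENNReal.natCast_ne_top _
    have hsum : (d.factorial : ℝ≥0∞) * (H.numEdges * (E.bind D).map decode e) =
        ∑ t ∈ enumerations d e, (H.cell L fun _ : Fin d => 0).card *
          E.bind D (fun j => code (t j)) := by
      rw [map_decode_apply hL _ hsupp, hroot, ← Finset.mul_sum]
      push_cast
      ring
    have hconst : ∀ x : ℝ≥0∞, ∑ _t ∈ enumerations d e, x = d.factorial * x := fun x => by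
      rw [Finset.sum_const, hcard, nsmul_eq_mul]
    constructor
    · rw [← ENNReal.mul_le_mul_iff_right hfac hfac', hsum, ← hconst]
      exact Finset.sum_le_sum fun t ht => (hbound t (hmem t ht)).1
    · rw [← ENNReal.mul_le_mul_iff_right hfac hfac', hsum, ← hconst]
      exact Finset.sum_le_sum fun t ht => (hbound t (hmem t ht)).2

end Correctness

end CIDAlgorithm

/-! ### Choice of the parameters -/

namespace CIDAlgorithm

open Hypergraph PMF

lemma natCast_mul_half_pow_le {X a T : ℕ} (h : X * 2 ^ a ≤ 2 ^ T) :
    (X : ℝ≥0∞) * (1 / 2) ^ T ≤ (1 / 2) ^ a := by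
  have h2 : ∀ m : ℕ, (2 : ℝ≥0∞) ^ m ≠ ⊤ := fun m => ENNReal.pow_ne_top (by norm_num)
  have h0 : ∀ m : ℕ, (2 : ℝ≥0∞) ^ m ≠ 0 := fun m => by positivity
  have hX : (X : ℝ≥0∞) * 2 ^ a ≤ 2 ^ T := by exact_mod_cast h
  rw [one_div, ← ENNReal.inv_pow, ← ENNReal.inv_pow, ENNReal.le_inv_iff_mul_le, mul_right_comm]
  calc (X : ℝ≥0∞) * 2 ^ a * (2 ^ T)⁻¹ ≤ 2 ^ T * (2 ^ T)⁻¹ := by gcongr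
    _ = 1 := ENNReal.mul_inv_cancel (h0 T) (h2 T)

/-- The numbers of repetitions are `repetitions d * L`. -/
def repetitions (d : ℕ) : ℕ := d ^ 2 + 6 * d + 6

lemma union_bound_le {d L n : ℕ} (hL : 1 ≤ L) (hn : n ≤ 2 ^ L) :
    (L + 1) * n ^ d * ((L + 1) ^ d * (5 * (4 * d * (L + 1)) ^ d + 1)) * 2 ^ (L * d + 1) ≤
      2 ^ (repetitions d * L) := by
  have h1 : L + 1 ≤ 2 ^ L := Nat.lt_two_pow_self
  have hd : d ≤ 2 ^ d := Nat.lt_two_pow_self.le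
  have hQ : (4 * d * (L + 1)) ^ d ≤ 2 ^ ((2 + d + L) * d) := by
    rw [pow_mul]
    refine Nat.pow_le_pow_left ?_ d
    rw [pow_add, pow_add]
    exact Nat.mul_le_mul (Nat.mul_le_mul (by norm_num) hd) h1
  have hR : 5 * (4 * d * (L + 1)) ^ d + 1 ≤ 2 ^ (3 + (2 + d + L) * d) := by
    rw [pow_add]
    have : 1 ≤ 2 ^ ((2 + d + L) * d) := Nat.one_le_two_pow
    omega
  have h2 : (L + 1) ^ d ≤ 2 ^ (L * d) := by
    rw [pow_mul]
    exact Nat.pow_le_pow_left h1 d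
  have h3 : n ^ d ≤ 2 ^ (L * d) := by
    rw [pow_mul]
    exact Nat.pow_le_pow_left hn d
  calc _ ≤ 2 ^ L * 2 ^ (L * d) * (2 ^ (L * d) * 2 ^ (3 + (2 + d + L) * d)) * 2 ^ (L * d + 1) := by
        gcongr
    _ = 2 ^ (L + L * d + (L * d + (3 + (2 + d + L) * d)) + (L * d + 1)) := by
        simp only [pow_add]
    _ ≤ _ := by
        refine Nat.pow_le_pow_right (by norm_num) ?_
        rw [repetitions]
        nlinarith [Nat.mul_le_mul_left (d ^ 2) hL, Nat.mul_le_mul_left d hL]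

lemma descent_bound_le {d L : ℕ} (hL : 1 ≤ L) :
    L * 2 ^ d * 2 ^ (L * d + 1) ≤ 2 ^ (repetitions d * L) := by
  have h1 : L ≤ 2 ^ L := Nat.lt_two_pow_self.le
  calc L * 2 ^ d * 2 ^ (L * d + 1) ≤ 2 ^ L * 2 ^ d * 2 ^ (L * d + 1) := by gcongr
    _ = 2 ^ (L + d + (L * d + 1)) := by simp only [pow_add]
    _ ≤ _ := by
        refine Nat.pow_le_pow_right (by norm_num) ?_
        rw [repetitions]
        nlinarith [Nat.mul_le_mul_left (d ^ 2) hL, Nat.mul_le_mul_left d hL]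

lemma half_pow_le_ofReal {d L n : ℕ} (hn0 : 0 < n) (hn : n ≤ 2 ^ L) :
    (1 / 2 : ℝ≥0∞) ^ (L * d) ≤ ENNReal.ofReal (1 / (n : ℝ) ^ ((1 : ℝ) * d)) := by
  have h : (1 / 2 : ℝ≥0∞) = ENNReal.ofReal (1 / 2) := by
    rw [ENNReal.ofReal_div_of_pos (by norm_num)]
    simp
  rw [h, ← ENNReal.ofReal_pow (by norm_num), one_mul, Real.rpow_natCast]
  refine ENNReal.ofReal_le_ofReal ?_
  rw [one_div, inv_pow, pow_mul, one_div]
  have hn0' : (0 : ℝ) < n := by exact_mod_cast hn0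
  have hn' : (n : ℝ) ≤ 2 ^ L := by exact_mod_cast hn
  exact inv_anti₀ (by positivity) (by gcongr)

lemma clog_le_log {n : ℕ} (hn : 2 ≤ n) : (Nat.clog 2 n : ℝ) ≤ 3 * Real.log n := by
  set L := Nat.clog 2 n with hL
  have hL1 : 1 ≤ L := Nat.clog_pos (by norm_num) hn
  have hpow : 2 ^ (L - 1) < n := by
    have := Nat.pow_pred_clog_lt_self (b := 2) (by norm_num) (x := n) (by omega)
    rwa [Nat.pred_eq_sub_one] at this
  have hlog2 := Real.log_two_gt_d9
  have h1 : ((L : ℝ) - 1) * Real.log 2 ≤ Real.log n := by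
    have h2 : Real.log ((2 : ℝ) ^ (L - 1)) ≤ Real.log n :=
      Real.log_le_log (by positivity) (by exact_mod_cast hpow.le)
    rw [Real.log_pow, Nat.cast_sub hL1] at h2
    simpa using h2
  have h3 : Real.log 2 ≤ Real.log n := Real.log_le_log (by norm_num) (by exact_mod_cast hn)
  have hL1' : (1 : ℝ) ≤ L := by exact_mod_cast hL1
  nlinarith

/-- The number of particles that makes the relative error of the particle filter small. -/
noncomputable def particles (d L : ℕ) (η : ℝ≥0) : ℕ :=
  ⌈32 * (80 * ((4 * d * (L + 1)) ^ d : ℕ)) * L / η ^ 2⌉₊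

/-- The factor that depends on `d` in the bound for the number of queries. -/
def queryFactor (d : ℕ) : ℕ := repetitions d ^ 2 * 51200 * ((8 * d) ^ d) ^ 2 * (2 ^ d) ^ 2

section

variable {d L : ℕ} {η : ℝ≥0}

lemma le_particles (hη0 : 0 < η) :
    32 * (80 * ((4 * d * (L + 1)) ^ d : ℕ)) * L ≤ η ^ 2 * particles d L η := by
  have h := Nat.le_ceil (32 * (80 * (((4 * d * (L + 1)) ^ d : ℕ) : ℝ≥0)) * L / η ^ 2)
  rw [div_le_iff₀ (by positivity)] at h
  rw [mul_comm (η ^ 2)]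
  exact h

lemma one_le_particles (hd : 1 ≤ d) (hL : 1 ≤ L) (hη0 : 0 < η) (hη : η ≤ 1) :
    1 ≤ 32 * (80 * (((4 * d * (L + 1)) ^ d : ℕ) : ℝ≥0)) * L / η ^ 2 := by
  rw [le_div_iff₀ (by positivity), one_mul]
  have hQ : 1 ≤ (4 * d * (L + 1)) ^ d := Nat.one_le_pow _ _ (by positivity)
  have hQ' : (1 : ℝ≥0) ≤ ((4 * d * (L + 1)) ^ d : ℕ) := by exact_mod_cast hQ
  have hL' : (1 : ℝ≥0) ≤ L := by exact_mod_cast hL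
  calc η ^ 2 ≤ 1 := pow_le_one₀ zero_le hη
    _ ≤ 32 * (80 * 1) * 1 := by norm_num
    _ ≤ _ := by gcongr

lemma particles_ne_zero (hd : 1 ≤ d) (hL : 1 ≤ L) (hη0 : 0 < η) (hη : η ≤ 1) :
    particles d L η ≠ 0 := by
  have h := (one_le_particles hd hL hη0 hη).trans
    (Nat.le_ceil (32 * (80 * (((4 * d * (L + 1)) ^ d : ℕ) : ℝ≥0)) * L / η ^ 2))
  intro h0
  rw [particles] at h0
  rw [h0] at h
  norm_num at h

lemma particles_le (hd : 1 ≤ d) (hL : 1 ≤ L) (hη0 : 0 < η) (hη : η ≤ 1) :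
    (particles d L η : ℝ) ≤ 5120 * (8 * d) ^ d * (L : ℝ) ^ (d + 1) / (η : ℝ) ^ 2 := by
  have h1 : (particles d L η : ℝ≥0) ≤
      2 * (32 * (80 * (((4 * d * (L + 1)) ^ d : ℕ) : ℝ≥0)) * L / η ^ 2) := by
    refine (Nat.ceil_lt_add_one zero_le).le.trans ?_
    rw [two_mul]
    gcongr
    exact one_le_particles hd hL hη0 hη
  have h2 : (particles d L η : ℝ) ≤
      2 * (32 * (80 * (4 * d * (L + 1 : ℝ)) ^ d) * L / (η : ℝ) ^ 2) := by exact_mod_cast h1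
  have hL' : (1 : ℝ) ≤ L := by exact_mod_cast hL
  refine h2.trans ?_
  have h3 : (4 * d * (L + 1 : ℝ)) ^ d ≤ (8 * d) ^ d * (L : ℝ) ^ d := by
    rw [← mul_pow]
    gcongr ?_ ^ d
    have : (d : ℝ) * (L + 1) ≤ d * (2 * L) := by gcongr; linarith
    linarith
  have hη' : (0 : ℝ) < (η : ℝ) ^ 2 := by positivity
  rw [← mul_div_assoc]
  refine div_le_div_of_nonneg_right ?_ hη'.le
  calc 2 * (32 * (80 * (4 * d * (L + 1 : ℝ)) ^ d) * L)
      ≤ 2 * (32 * (80 * ((8 * d) ^ d * (L : ℝ) ^ d)) * L) := by gcongr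
    _ = _ := by ring

lemma queries_estimate_le (hd : 1 ≤ d) (hL : 1 ≤ L) (hη0 : 0 < η) (hη : η ≤ 1) :
    ((repetitions d * L * ((L + 1) * (particles d L η * 2 ^ d * ((L + 1) ^ d *
      (repetitions d * L * (5 * (4 * d * (L + 1)) ^ d))))) : ℕ) : ℝ) ≤
      queryFactor d * (L : ℝ) ^ (3 * d + 4) / (η : ℝ) ^ 2 := by
  have hL' : (1 : ℝ) ≤ L := by exact_mod_cast hL
  have h2L : (L : ℝ) + 1 ≤ 2 * L := by linarith
  have hQ : (4 * d * (L + 1 : ℝ)) ^ d ≤ (8 * d) ^ d * (L : ℝ) ^ d := by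
    rw [← mul_pow]
    gcongr ?_ ^ d
    have : (d : ℝ) * (L + 1) ≤ d * (2 * L) := by gcongr
    linarith
  have hk := particles_le hd hL hη0 hη
  have hη' : (0 : ℝ) < (η : ℝ) ^ 2 := by positivity
  rw [queryFactor]
  push_cast
  calc (repetitions d : ℝ) * L * ((L + 1) * (particles d L η * 2 ^ d * ((L + 1) ^ d *
        (repetitions d * L * (5 * (4 * d * (L + 1)) ^ d)))))
      ≤ (repetitions d : ℝ) * L * ((2 * L) * ((5120 * (8 * d) ^ d * (L : ℝ) ^ (d + 1) / η ^ 2) *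
        2 ^ d * ((2 * L) ^ d * (repetitions d * L * (5 * ((8 * d) ^ d * (L : ℝ) ^ d)))))) := by
        gcongr
    _ = _ := by
        rw [mul_pow 2 (L : ℝ) d, show 3 * d + 4 = d + d + d + 4 by ring]
        simp only [pow_add]
        field_simp
        ring

end

variable {V : Type} [Fintype V] {d : ℕ}

lemma exists_estimator (hd : 1 ≤ d) (hn : 2 ≤ Fintype.card V) {ε : ℝ} (hε0 : 0 < ε)
    (hε1 : ε < 1) :
    ∃ (alg : CIDAlgorithm V d ℝ) (N : ℕ),
      alg.EstimatesHyperedges ε (1 / (Fintype.card V : ℝ) ^ ((1 : ℝ) * d)) ∧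
      alg.QueriesAtMost N ∧
      (N : ℝ) ≤ 16 * queryFactor d * 3 ^ (3 * d + 5) *
        (Real.log (Fintype.card V : ℝ) ^ (3 * d + 5) / ε ^ 2) := by
  have : NeZero d := ⟨by omega⟩
  lift ε to ℝ≥0 using hε0.le
  set n := Fintype.card V with hnV
  set L := Nat.clog 2 n with hLdef
  have hL1 : 1 ≤ L := Nat.clog_pos (by norm_num) hn
  have hnL : n ≤ 2 ^ L := Nat.le_pow_clog (by norm_num) n
  set η : ℝ≥0 := ε / 4 with hη
  have hε0' : 0 < ε := by exact_mod_cast hε0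
  have hε1' : ε < 1 := by exact_mod_cast hε1
  have hη0 : 0 < η := by positivity
  have hηR : (η : ℝ) = ε / 4 := by rw [hη]; push_cast; rfl
  have hη2 : η ≤ 1 / 2 := by
    rw [← NNReal.coe_le_coe, hηR]
    push_cast
    linarith
  have hη1 : η ≤ 1 := hη2.trans (by rw [← NNReal.coe_le_coe]; norm_num)
  set T := repetitions d * L with hT
  refine ⟨estimateAlg V d L (5 * (4 * d * (L + 1)) ^ d) T (particles d L η) η, _, ?_,
    queriesAtMost_estimateAlg _ _ _ _ _, ?_⟩
  · intro H _ hH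
    have h := toOuterMeasure_estimateAlg_le (T := T) hH hnL le_rfl
      (particles_ne_zero hd hL1 hη0 hη1) hη0 hη2 (le_particles hη0)
      (natCast_mul_half_pow_le (union_bound_le hL1 hnL))
    have h4 : 4 * (η : ℝ) = ε := by rw [hηR]; ring
    rw [h4] at h
    have hsmall : (1 / 2 : ℝ≥0∞) ^ (L * d + 1) + (1 / 2) ^ T ≤
        ENNReal.ofReal (1 / (n : ℝ) ^ ((1 : ℝ) * d)) := by
      refine le_trans ?_ (half_pow_le_ofReal (by omega) hnL)
      have hT' : (1 / 2 : ℝ≥0∞) ^ T ≤ (1 / 2) ^ (L * d + 1) := by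
        have := natCast_mul_half_pow_le (X := 1) (a := L * d + 1) (T := T) (by
          refine le_trans ?_ (descent_bound_le (d := d) hL1)
          gcongr
          exact Nat.one_le_iff_ne_zero.2 (by positivity))
        simpa using this
      calc (1 / 2 : ℝ≥0∞) ^ (L * d + 1) + (1 / 2) ^ T
          ≤ (1 / 2) ^ (L * d + 1) + (1 / 2) ^ (L * d + 1) := by gcongr
        _ = (1 / 2) ^ (L * d) := by
            rw [pow_succ, ← mul_add, ENNReal.add_halves, mul_one]
    have := one_sub_le_toOuterMeasure _ (h.trans hsmall)
    rwa [← ENNReal.ofReal_one, ← ENNReal.ofReal_sub _ (by positivity)] at this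
  · refine (queries_estimate_le hd hL1 hη0 hη1).trans ?_
    have hL' : (1 : ℝ) ≤ L := by exact_mod_cast hL1
    have hlog : (L : ℝ) ≤ 3 * Real.log n := clog_le_log hn
    have hlog0 : 0 ≤ Real.log (n : ℝ) := Real.log_natCast_nonneg n
    calc (queryFactor d : ℝ) * (L : ℝ) ^ (3 * d + 4) / (η : ℝ) ^ 2
        = 16 * queryFactor d * (L : ℝ) ^ (3 * d + 4) / (ε : ℝ) ^ 2 := by
          rw [hηR]
          field_simp
          norm_num
      _ ≤ 16 * queryFactor d * (3 * Real.log n) ^ (3 * d + 5) / (ε : ℝ) ^ 2 := by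
          gcongr
          calc (L : ℝ) ^ (3 * d + 4) ≤ (L : ℝ) ^ (3 * d + 5) :=
                pow_le_pow_right₀ hL' (by omega)
            _ ≤ _ := by gcongr
      _ = _ := by
          rw [mul_pow]
          ring

lemma exists_sampler (hd : 1 ≤ d) (hn : 2 ≤ Fintype.card V) {ε : ℝ} (hε0 : 0 < ε)
    (hε1 : ε < 1) :
    ∃ (alg : CIDAlgorithm V d (Set V)) (N : ℕ),
      alg.SamplesHyperedges ε (1 / (Fintype.card V : ℝ) ^ ((1 : ℝ) * d)) ∧
      alg.QueriesAtMost N ∧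
      (N : ℝ) ≤ 1024 * 2 ^ d * queryFactor d * 3 ^ (3 * d + 9) *
        (Real.log (Fintype.card V : ℝ) ^ (3 * d + 9) / ε ^ 2) := by
  have : NeZero d := ⟨by omega⟩
  lift ε to ℝ≥0 using hε0.le
  set n := Fintype.card V with hnV
  set L := Nat.clog 2 n with hLdef
  have hL1 : 1 ≤ L := Nat.clog_pos (by norm_num) hn
  have hnL : n ≤ 2 ^ L := Nat.le_pow_clog (by norm_num) n
  have hL' : (1 : ℝ) ≤ L := by exact_mod_cast hL1
  have hε0' : 0 < ε := by exact_mod_cast hε0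
  -- The errors of the `L` steps of the descent accumulate to `(1 + 16 * η) ^ L ≤ 1 + ε`.
  set η : ℝ≥0 := ε / (32 * L) with hη
  have hη0 : 0 < η := by positivity
  have hηR : (η : ℝ) = ε / (32 * L) := by rw [hη]; push_cast; rfl
  have hηL : 32 * (L * (η : ℝ)) = ε := by rw [hηR]; field_simp
  have hη0R : (0 : ℝ) < η := hη0
  have hηle : (η : ℝ) ≤ L * η := le_mul_of_one_le_left hη0R.le hL'
  have hη8 : 8 * η ≤ 1 := by
    rw [← NNReal.coe_le_coe]
    push_cast
    linarith
  have hη1 : η ≤ 1 := by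
    rw [← NNReal.coe_le_coe]
    push_cast
    linarith
  set T := repetitions d * L with hT
  refine ⟨sampleAlg V d L (5 * (4 * d * (L + 1)) ^ d) T (particles d L η) η, _, ?_,
    queriesAtMost_sampleAlg _ _ _ _ _, ?_⟩
  · intro H _ hH hne
    have hhalf : (1 / 2 : ℝ≥0∞) ^ (L * d + 1) < 1 := by
      refine pow_lt_one₀ zero_le ?_ (by omega)
      rw [one_div]
      exact ENNReal.inv_lt_one.2 (by norm_num)
    have hdesc : (L : ℝ≥0∞) * (2 ^ d * (1 / 2) ^ T) ≤ (1 / 2) ^ (L * d + 1) := by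
      have := natCast_mul_half_pow_le (descent_bound_le (d := d) hL1)
      push_cast at this
      rwa [mul_assoc] at this
    have hT1 : 2 ^ d * (1 / 2 : ℝ≥0∞) ^ T < 1 := by
      refine lt_of_le_of_lt (le_trans ?_ hdesc) hhalf
      have : (1 : ℝ≥0∞) ≤ L := by exact_mod_cast hL1
      exact le_mul_of_one_le_left zero_le this
    obtain ⟨D, hnear, hsupp, hD⟩ := exists_sampleAlg_near (T := T) hH hnL le_rfl
      (particles_ne_zero hd hL1 hη0 hη1) hη0 hη8 (le_particles hη0)
      (natCast_mul_half_pow_le (union_bound_le hL1 hnL)) hhalf hT1 hne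
    have hn0 : (0 : ℝ) < n := by
      have : 0 < n := by omega
      exact_mod_cast this
    set t : ℝ := 1 / (n : ℝ) ^ ((1 : ℝ) * d) with ht
    have ht0 : 0 < t := by positivity
    have ht1 : t ≤ 1 := by
      rw [ht, one_mul, Real.rpow_natCast]
      refine div_le_one_of_le₀ (one_le_pow₀ ?_) (by positivity)
      have : 1 ≤ n := by omega
      exact_mod_cast this
    have hmix : ∀ e, ENNReal.ofReal (1 - t) * D e ≤
        (sampleAlg V d L (5 * (4 * d * (L + 1)) ^ d) T (particles d L η) η).law H e := by
      intro e
      refine le_trans ?_ (hnear e)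
      gcongr
      rw [ENNReal.ofReal_sub _ ht0.le, ENNReal.ofReal_one]
      refine tsub_le_tsub_left ?_ 1
      refine le_trans ?_ (half_pow_le_ofReal (by omega) hnL)
      calc (1 / 2 : ℝ≥0∞) ^ (L * d + 1) + L * (2 ^ d * (1 / 2) ^ T)
          ≤ (1 / 2) ^ (L * d + 1) + (1 / 2) ^ (L * d + 1) := by gcongr
        _ = (1 / 2) ^ (L * d) := by
            rw [pow_succ, ← mul_add, ENNReal.add_halves, mul_one]
    obtain ⟨R, hR⟩ := exists_mixture _ D ht0 ht1 hmix
    refine ⟨D, R, t, ht0.le, ht1, le_rfl, hsupp, fun e he => ?_, hR⟩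
    obtain ⟨h1, h2⟩ := hD e he
    have hm : (0 : ℝ) < H.numEdges := by
      have : 0 < H.numEdges := (Set.ncard_pos (Set.toFinite _)).2 ⟨e, he⟩
      exact_mod_cast this
    have hcoe : (H.numEdges : ℝ≥0∞) * D e = ENNReal.ofReal (H.numEdges * (D e).toReal) := by
      rw [ENNReal.ofReal_mul (by positivity), ENNReal.ofReal_natCast,
        ENNReal.ofReal_toReal (D.apply_ne_top e)]
    rw [hcoe] at h1 h2
    have h1' : (1 - 8 * (η : ℝ)) ^ L ≤ H.numEdges * (D e).toReal := by
      rw [← ENNReal.coe_pow, ← ENNReal.ofReal_coe_nnreal,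
        ENNReal.ofReal_le_ofReal_iff (by positivity)] at h1
      rw [NNReal.coe_pow, NNReal.coe_sub hη8] at h1
      exact_mod_cast h1
    have h2' : H.numEdges * (D e).toReal ≤ (1 + 16 * (η : ℝ)) ^ L := by
      rw [← ENNReal.coe_pow, ← ENNReal.ofReal_coe_nnreal,
        ENNReal.ofReal_le_ofReal_iff (by positivity)] at h2
      exact_mod_cast h2
    have hlow : 1 - (ε : ℝ) ≤ (1 - 8 * (η : ℝ)) ^ L := by
      have hB := one_add_mul_le_pow (a := -(8 * (η : ℝ))) (by
        have : 8 * (η : ℝ) ≤ 1 := by exact_mod_cast hη8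
        linarith) L
      have hpos : 0 ≤ L * (η : ℝ) := by positivity
      rw [← sub_eq_add_neg 1 (8 * (η : ℝ))] at hB
      linarith
    have hup : (1 + 16 * (η : ℝ)) ^ L ≤ 1 + ε := by
      have h16 := one_add_pow_le (x := 16 * η) (r := L) (by
        rw [← NNReal.coe_le_coe]
        push_cast
        linarith)
      have h16' : (1 + 16 * (η : ℝ)) ^ L ≤ 1 + 2 * (L * (16 * (η : ℝ))) := by exact_mod_cast h16
      linarith
    rw [Set.mem_Icc, mul_one_div, mul_one_div, div_le_iff₀ hm, le_div_iff₀ hm,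
      mul_comm (D e).toReal]
    exact ⟨hlow.trans h1', h2'.trans hup⟩
  · have hlog : (L : ℝ) ≤ 3 * Real.log n := clog_le_log hn
    have hlog0 : 0 ≤ Real.log (n : ℝ) := Real.log_natCast_nonneg n
    have hq := queries_estimate_le hd hL1 hη0 hη1
    rw [← hT] at hq
    rw [Nat.cast_mul, Nat.cast_mul (2 ^ d)]
    calc _ ≤ (L : ℝ) * (((2 ^ d : ℕ) : ℝ) *
          (queryFactor d * (L : ℝ) ^ (3 * d + 4) / (η : ℝ) ^ 2)) := by gcongr
      _ = 1024 * 2 ^ d * queryFactor d * (L : ℝ) ^ (3 * d + 7) / (ε : ℝ) ^ 2 := by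
          rw [hηR, show 3 * d + 7 = 3 * d + 4 + 3 by ring, pow_add _ (3 * d + 4) 3]
          push_cast
          field_simp
          ring
      _ ≤ 1024 * 2 ^ d * queryFactor d * (3 * Real.log n) ^ (3 * d + 9) / (ε : ℝ) ^ 2 := by
          gcongr
          calc (L : ℝ) ^ (3 * d + 7) ≤ (L : ℝ) ^ (3 * d + 9) :=
                pow_le_pow_right₀ hL' (by omega)
            _ ≤ _ := by gcongr
      _ = _ := by
          rw [mul_pow]
          ring

/-- For at most one vertex no query is allowed. Without vertices there is no hyperedge, and for a
single vertex the failure probability may be `1`. -/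
lemma estimatesHyperedges_of_card_le_one (hd : 1 ≤ d) (hn : Fintype.card V ≤ 1) {ε : ℝ} :
    (output 0 : CIDAlgorithm V d ℝ).EstimatesHyperedges ε
      (1 / (Fintype.card V : ℝ) ^ ((1 : ℝ) * d)) := by
  intro H _ hH
  rcases Nat.le_one_iff_eq_zero_or_eq_one.1 hn with h0 | h1
  · have : IsEmpty V := Fintype.card_eq_zero_iff.1 h0
    have hE : H.numEdges = 0 := by
      rw [Hypergraph.numEdges, Set.ncard_eq_zero (Set.toFinite _), Set.eq_empty_iff_forall_notMem]
      intro e he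
      have := hH e he
      rw [Set.eq_empty_of_isEmpty e, Set.ncard_empty] at this
      omega
    rw [law, PMF.toOuterMeasure_pure_apply, if_pos (by simp [hE])]
    exact ENNReal.ofReal_le_one.2 (sub_le_self _ (by positivity))
  · simp [h1]

lemma samplesHyperedges_of_card_le_one (hd : 1 ≤ d) (hn : Fintype.card V ≤ 1) {ε : ℝ} (hε : 0 < ε) :
    (output ∅ : CIDAlgorithm V d (Set V)).SamplesHyperedges ε
      (1 / (Fintype.card V : ℝ) ^ ((1 : ℝ) * d)) := by
  classical
  intro H _ hH hne
  rcases Nat.le_one_iff_eq_zero_or_eq_one.1 hn with h0 | h1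
  · have : IsEmpty V := Fintype.card_eq_zero_iff.1 h0
    obtain ⟨e, he⟩ := hne
    have := hH e he
    rw [Set.eq_empty_of_isEmpty e, Set.ncard_empty] at this
    omega
  · refine ⟨PMF.uniformOfFinset H.edgeSet.toFinset (Set.toFinset_nonempty.2 hne),
      (output ∅ : CIDAlgorithm V d (Set V)).law H, 1, zero_le_one, le_rfl, by simp [h1], ?_,
      fun e he => ?_, fun e => by simp⟩
    · simp
    · rw [PMF.uniformOfFinset_apply_of_mem _ (Set.mem_toFinset.2 he), ENNReal.toReal_inv,
        ENNReal.toReal_natCast, ← Set.ncard_eq_toFinset_card']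
      have hinv : (0 : ℝ) ≤ ((H.edgeSet.ncard : ℕ) : ℝ)⁻¹ := by positivity
      rw [Hypergraph.numEdges, one_div]
      constructor <;> nlinarith

end CIDAlgorithm

theorem mainTheorem2 :
    ∃ c : ℝ, 0 < c ∧ ∀ d : ℕ, 1 ≤ d → ∃ C : ℝ, 0 < C ∧
      ∀ (V : Type) [Fintype V] (ε : ℝ), 0 < ε → ε < 1 →
        (∃ (alg : CIDAlgorithm V d ℝ) (N : ℕ),
          alg.EstimatesHyperedges ε (1 / (Fintype.card V : ℝ) ^ (c * (d : ℝ))) ∧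
          alg.QueriesAtMost N ∧
          (N : ℝ) ≤ C * (Real.log (Fintype.card V : ℝ) ^ (3 * d + 5) / ε ^ 2)) ∧
        (∃ (alg : CIDAlgorithm V d (Set V)) (N : ℕ),
          alg.SamplesHyperedges ε (1 / (Fintype.card V : ℝ) ^ (c * (d : ℝ))) ∧
          alg.QueriesAtMost N ∧
          (N : ℝ) ≤ C * (Real.log (Fintype.card V : ℝ) ^ (3 * d + 9) / ε ^ 2)) := by
  refine ⟨1, one_pos, fun d hd => ?_⟩
  set C₁ : ℝ := 16 * CIDAlgorithm.queryFactor d * 3 ^ (3 * d + 5) with hC₁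
  set C₂ : ℝ := 1024 * 2 ^ d * CIDAlgorithm.queryFactor d * 3 ^ (3 * d + 9) with hC₂
  refine ⟨1 + C₁ + C₂, by positivity, fun V _ ε hε0 hε1 => ?_⟩
  have hlog : 0 ≤ Real.log (Fintype.card V : ℝ) := Real.log_natCast_nonneg _
  rcases Nat.lt_or_ge 1 (Fintype.card V) with hn | hn
  · obtain ⟨alg₁, N₁, h₁, hq₁, hN₁⟩ := CIDAlgorithm.exists_estimator hd hn hε0 hε1
    obtain ⟨alg₂, N₂, h₂, hq₂, hN₂⟩ := CIDAlgorithm.exists_sampler hd hn hε0 hε1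
    refine ⟨⟨alg₁, N₁, h₁, hq₁, hN₁.trans ?_⟩, ⟨alg₂, N₂, h₂, hq₂, hN₂.trans ?_⟩⟩
    · rw [← hC₁]
      gcongr
      have : 0 ≤ C₂ := by positivity
      linarith
    · rw [← hC₂]
      gcongr
      have : 0 ≤ C₁ := by positivity
      linarith
  · refine ⟨⟨_, 0, CIDAlgorithm.estimatesHyperedges_of_card_le_one hd hn, trivial, ?_⟩,
      ⟨_, 0, CIDAlgorithm.samplesHyperedges_of_card_le_one hd hn hε0, trivial, ?_⟩⟩
    · push_cast
      positivity
    · push_cast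
      positivity
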